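/- \textbf{Proposition (Pauli twirling the encoding channel).} \emph{Setting.} Consider adaptive quantum circuits built from one- and two-qubit unitary gates, initializations of qubits in $|0\rangle$ and computational-basis measurements, with perfect classical computation, control and randomness. Under circuit-level stochastic noise of strength $p\in[0,1]$ every quantum component $\mathcal P$ is realized by $(1-p)\mathcal P+p\,\mathcal N_{\mathcal P}$ for some quantum channel $\mathcal N_{\mathcal P}$ with the same input and output registers; $\widetilde{\mathcal C}$ denotes the resulting noisy implementation of a circuit $\mathcal C$ (the channels $\mathcal N_{\mathcal P}$ are a fixed function of the circuit location and the operation, so that a given subcircuit has one noisy implementation). Let a quantum code encode $n$ qubits into $n'$ physical qubits by an isometry $E$, and write $\mathcal E[\rho]=E\rho E^\dagger$. Let $\mathcal Q$ be a QEC projector: a channel on $n'$ qubits whose outputs are supported on the code space and which fixes all operators supported on the code space. Let $\mathcal Q_{\rm FT}$ be a circuit that implements $\mathcal Q$ in the absence of noise, and for every $n$-qubit Pauli operator $G=\mathrm i^{a\cdot b}X^bZ^a$, $a,b\in\mathbb F_2^n$, let $\mathcal G_{\rm FT}$ be a circuit that in the absence of noise acts on code states as the logical gate $\overline{\mathcal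 G}[\cdot]=\overline G\,[\cdot]\,\overline G^\dagger$, $\overline G=EGE^\dagger$. Let $$\Gamma(\mathcal E)=\sup\ \tfrac12\big\|\overline{\mathcal G}\circ\mathcal Q\circ\widetilde{\mathcal Q}_{\rm FT}-\mathcal Q\circ\widetilde{\mathcal Q}_{\rm FT}\circ\widetilde{\mathcal G}_{\rm FT}\circ\widetilde{\mathcal Q}_{\rm FT}\big\|_\diamond ,$$ the supremum being over all Pauli operators $G$ and all circuit-level stochastic noise of strength $p$. An encoding gadget is a circuit $\mathcal E'_{\rm FT}$ from $n$ to $n'$ qubits that implements $\mathcal E$ in the absence of noise. For given noise its encoding error is $\varepsilon_{\rm enc}=\sup_\rho\frac12\|\mathcal Q\circ\widetilde{\mathcal Q}_{\rm FT}\circ\widetilde{\mathcal E}'_{\rm FT}[\rho]-\mathcal E[\rho]\|_1$ over $n$-qubit states $\rho$. Its Pauli twirl $\mathcal E_{\rm FT}$ is the circuit that draws an $n$-qubit Pauli operator $G$ uniformly at random, applies $G$ to the $n$ physical input qubits as $n$ single-qubit Pauli gates (identities included), and then applies $\mathcal E'_{\rm FT}$, $\mathcal Q_{\rm FT}$ and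 $\mathcal G_{\rm FT}$. For a dataset $g:\mathbb F_2^n\to\mathbb F_2$ let $|\Psi(g)\rangle=2^{-n/2}\sum_x(-1)^{g(x)}|x\rangle$ and $|\overline{\Psi(g)}\rangle=E|\Psi(g)\rangle$. \emph{Claim.} For every encoding gadget $\mathcal E'_{\rm FT}$, its Pauli twirl $\mathcal E_{\rm FT}$ is again an encoding gadget, and under every circuit-level stochastic noise of strength $p$, for all datasets $g$ and all $n$-qubit states $\widetilde\psi(g)$ (in particular those produced by a noisy QRAM device), with $F(g)_{\rm phys}=\langle\Psi(g)|\widetilde\psi(g)|\Psi(g)\rangle$ and $\overline{\phi(g)}=\mathcal Q\circ\widetilde{\mathcal Q}_{\rm FT}\circ\widetilde{\mathcal E}_{\rm FT}[\widetilde\psi(g)]$, $$\langle\overline{\Psi(g)}|\,\overline{\phi(g)}\,|\overline{\Psi(g)}\rangle\ \ge\ (1-p)^n\Big((1-3\varepsilon_{\rm enc})F(g)_{\rm phys}-2\Gamma(\mathcal E)\Big),$$ where $\varepsilon_{\rm enc}$ is the encoding error of $\mathcal E'_{\rm FT}$. Moreover, let a sequence of such codes with gadgets be given and suppose it has a threshold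 $p_0>0$, i.e. for each noise strength $p'<p_0$ the logical errors $\frac12\|\cdots\|_\diamond$ above become arbitrarily small far out in the sequence, uniformly in the noise of strength $p'$ and in $G$. If $p<p_0$, then $\Gamma(\mathcal E)\to0$ along the sequence. -/

import Mathlib

open scoped Matrix ComplexOrder

/-! ### Registers, operators, channels -/

/-- Operators on a register of `n` qubits; the computational basis is indexed by bit strings
`x ∈ 𝔽₂ⁿ`. -/
abbrev Op (n : ℕ) : Type := Matrix (Fin n → ZMod 2) (Fin n → ZMod 2) ℂ

/-- A density matrix: positive semidefinite of trace one. -/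
def IsDensity {a : Type} [Fintype a] (ρ : Matrix a a ℂ) : Prop :=
  ρ.PosSemidef ∧ ρ.trace = 1

/-- The ampliation `Φ ⊗ id` of a superoperator `Φ` by an `r`-dimensional reference system. -/
def ampliation {a b : Type} (r : ℕ) (Φ : Matrix a a ℂ →ₗ[ℂ] Matrix b b ℂ)
    (M : Matrix (a × Fin r) (a × Fin r) ℂ) : Matrix (b × Fin r) (b × Fin r) ℂ :=
  Matrix.of fun x y => Φ (Matrix.of fun u v => M (u, x.2) (v, y.2)) x.1 y.1

/-- Quantum channels: completely positive trace-preserving maps. -/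
def IsChannel {a b : Type} [Fintype a] [Fintype b]
    (Φ : Matrix a a ℂ →ₗ[ℂ] Matrix b b ℂ) : Prop :=
  (∀ (r : ℕ) (M : Matrix (a × Fin r) (a × Fin r) ℂ), M.PosSemidef → (ampliation r Φ M).PosSemidef) ∧
    ∀ M : Matrix a a ℂ, (Φ M).trace = M.trace

/-- The map `M ↦ K M Kᴴ`. -/
def sandwich {a b : Type} [Fintype a] (K : Matrix b a ℂ) :
    Matrix a a ℂ →ₗ[ℂ] Matrix b b ℂ where
  toFun M := K * M * Kᴴ
  map_add' M N := by simp [Matrix.mul_add, Matrix.add_mul]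
  map_smul' c M := by simp

/-- The trace norm `‖M‖₁`: the sum of the singular values of `M`, i.e. of the square roots of the
eigenvalues of `Mᴴ M`. -/
noncomputable def traceNorm {a : Type} [Fintype a] [DecidableEq a] (M : Matrix a a ℂ) : ℝ :=
  ∑ i, Real.sqrt ((Matrix.isHermitian_conjTranspose_mul_self M).eigenvalues i)

/-- The diamond norm: the supremum of `‖(Φ ⊗ id_r) M‖₁` over all reference systems and all `M`
with `‖M‖₁ ≤ 1`. -/
noncomputable def diamondNorm {a b : Type} [Fintype a] [DecidableEq a] [Fintype b] [DecidableEq b]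
    (Φ : Matrix a a ℂ →ₗ[ℂ] Matrix b b ℂ) : ℝ :=
  sSup {s : ℝ | ∃ (r : ℕ) (M : Matrix (a × Fin r) (a × Fin r) ℂ),
    traceNorm M ≤ 1 ∧ s = traceNorm (ampliation r Φ M)}

/-- The fidelity `⟨v| M |v⟩` of a state `M` with a pure state `v`. -/
def fidelity {a : Type} [Fintype a] (v : a → ℂ) (M : Matrix a a ℂ) : ℝ :=
  (star v ⬝ᵥ (M *ᵥ v)).re

/-! ### Pauli operators and QRAM resource states -/

/-- A label `(a, b)` for the `n`-qubit Pauli operator `i^{a·b} X^b Z^a`. -/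
abbrev PauliLabel (n : ℕ) : Type := (Fin n → ZMod 2) × (Fin n → ZMod 2)

/-- The `n`-qubit Hermitian Pauli operator `i^{a·b} X^b Z^a` (with `a·b ∈ {0, 1}`), where
`X^b Z^a |x⟩ = (-1)^{a·x} |x + b⟩`. -/
noncomputable def pauli {n : ℕ} (P : PauliLabel n) : Op n :=
  Matrix.of fun y x =>
    if y = x + P.2 then Complex.I ^ (P.1 ⬝ᵥ P.2).val * (-1 : ℂ) ^ (P.1 ⬝ᵥ x).val else 0

theorem pauli_mem_unitary {n : ℕ} (P : PauliLabel n) :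
    pauli P ∈ Matrix.unitaryGroup (Fin n → ZMod 2) ℂ := by
  rw [Matrix.mem_unitaryGroup_iff']
  ext x y
  rw [Matrix.mul_apply, Finset.sum_eq_single (x + P.2)]
  · by_cases h : x = y
    · subst h
      simp only [pauli, Matrix.star_apply, Matrix.of_apply, if_true, Matrix.one_apply_eq]
      rw [RCLike.star_def, ← Complex.normSq_eq_conj_mul_self]
      simp
    · have h' : ¬ x + P.2 = y + P.2 := fun e => h (add_right_cancel e)
      simp [pauli, h, h']
  · intro z _ hz
    simp [pauli, hz]
  · simp

/-- The diagonal QRAM unitary `V(g) = ∑ₓ (-1)^{g(x)} |x⟩⟨x|` of a dataset `g`. -/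
def qramUnitary {n : ℕ} (g : (Fin n → ZMod 2) → ZMod 2) : Op n :=
  Matrix.diagonal fun x => (-1 : ℂ) ^ (g x).val

/-- The state `|+⟩^{⊗ n}`. -/
noncomputable def plusState (n : ℕ) : (Fin n → ZMod 2) → ℂ :=
  fun _ => ((Real.sqrt (2 ^ n))⁻¹ : ℝ)

/-- The resource state `|Ψ(g)⟩ = V(g) |+⟩^{⊗ n}`. -/
noncomputable def resourceState {n : ℕ} (g : (Fin n → ZMod 2) → ZMod 2) : (Fin n → ZMod 2) → ℂ :=
  qramUnitary g *ᵥ plusState n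

/-! ### Action of elementary operations on part of a register -/

/-- The superoperator `Φ ⊗ id` on `m` qubits, with the `k`-qubit superoperator `Φ` acting on the
qubits `e 0, …, e (k - 1)`. -/
noncomputable def actOn {m k : ℕ} (e : Fin k ↪ Fin m) (Φ : Op k →ₗ[ℂ] Op k) : Op m →ₗ[ℂ] Op m where
  toFun M := Matrix.of fun x y =>
    Φ (Matrix.of fun u v => M (Function.extend e u x) (Function.extend e v y)) (x ∘ e) (y ∘ e)
  map_add' M N := by
    ext x y
    have h : (Matrix.of fun u v => (M + N) (Function.extend e u x) (Function.extend e v y)) =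
        (Matrix.of fun u v => M (Function.extend e u x) (Function.extend e v y)) +
        (Matrix.of fun u v => N (Function.extend e u x) (Function.extend e v y)) := rfl
    simp only [Matrix.of_apply, Matrix.add_apply]
    exact (congrArg (fun A => Φ A (x ∘ e) (y ∘ e)) h).trans (by rw [map_add]; rfl)
  map_smul' c M := by
    ext x y
    have h : (Matrix.of fun u v => (c • M) (Function.extend e u x) (Function.extend e v y)) =
        c • (Matrix.of fun u v => M (Function.extend e u x) (Function.extend e v y)) := rfl
    simp only [Matrix.of_apply, Matrix.smul_apply, RingHom.id_apply]
    exact (congrArg (fun A => Φ A (x ∘ e) (y ∘ e)) h).trans (by rw [map_smul]; rfl)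

/-- Insert a fresh qubit in the state `σ` at position `i`. -/
def insertQubit {m : ℕ} (i : Fin (m + 1)) (σ : Matrix (ZMod 2) (ZMod 2) ℂ) :
    Op m →ₗ[ℂ] Op (m + 1) where
  toFun M := Matrix.of fun x y => σ (x i) (y i) * M (i.removeNth x) (i.removeNth y)
  map_add' M N := by ext x y; simp [mul_add]
  map_smul' c M := by ext x y; simp [mul_left_comm]

/-- Measure qubit `i` destructively, with outcome described by the effect `A`:
`M ↦ Tr_i [(A ⊗ 1) M]`, unnormalized. -/
def removeQubit {m : ℕ} (i : Fin (m + 1)) (A : Matrix (ZMod 2) (ZMod 2) ℂ) :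
    Op (m + 1) →ₗ[ℂ] Op m where
  toFun M := Matrix.of fun x y =>
    ∑ a, ∑ b, A b a * M (i.insertNth a x) (i.insertNth b y)
  map_add' M N := by ext x y; simp [mul_add, Finset.sum_add_distrib]
  map_smul' c M := by ext x y; simp [mul_left_comm, Finset.mul_sum]

/-! ### Adaptive quantum circuits and circuit-level stochastic noise -/

/-- Adaptive quantum circuits with `out` output qubits, indexed by the number of current qubits.
The quantum components are one- and two-qubit gates, initializations of a qubit, and destructive
computational-basis measurements; each carries a tag in `ℕ` identifying the circuit location, so
that the noise may differ between occurrences of the same operation. Classical computation,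
classical control and classical randomness are perfect: the rest of the circuit is an arbitrary
function of the measurement outcome or of the sampled random variable. -/
inductive Circuit (out : ℕ) : ℕ → Type 1
  | done : Circuit out out
  | gate {m k : ℕ} (tag : ℕ) (hk : k = 1 ∨ k = 2) (e : Fin k ↪ Fin m)
      (U : Matrix.unitaryGroup (Fin k → ZMod 2) ℂ) (next : Circuit out m) : Circuit out m
  | prepare {m : ℕ} (tag : ℕ) (i : Fin (m + 1)) (next : Circuit out (m + 1)) : Circuit out m
  | measure {m : ℕ} (tag : ℕ) (i : Fin (m + 1)) (next : ZMod 2 → Circuit out m) :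
      Circuit out (m + 1)
  | random {m : ℕ} (α : Type) [Fintype α] (w : α → ℝ) (hw : ∀ a, 0 ≤ w a) (hw1 : ∑ a, w a = 1)
      (next : α → Circuit out m) : Circuit out m

/-- A physical realization of all quantum components: a superoperator for every gate, a state for
every initialization and a family of effects for every measurement. -/
structure Realization where
  gate : (tag m k : ℕ) → (Fin k ↪ Fin m) → Matrix.unitaryGroup (Fin k → ZMod 2) ℂ →
    (Op k →ₗ[ℂ] Op k)
  prepare : (tag m : ℕ) → Fin (m + 1) → Matrix (ZMod 2) (ZMod 2) ℂ
  measure : (tag m : ℕ) → Fin (m + 1) → ZMod 2 → Matrix (ZMod 2) (ZMod 2) ℂ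

namespace Realization

/-- The noiseless realization. -/
noncomputable def ideal : Realization where
  gate _ _ _ _ U := sandwich (U : Matrix _ _ ℂ)
  prepare _ _ _ := Matrix.single 0 0 1
  measure _ _ _ o := Matrix.single o o 1

/-- Every component is realized by some quantum channel with the right input and output registers
(a channel with no input is a state; a channel from a qubit to a bit is a two-outcome POVM). -/
def IsPhysical (N : Realization) : Prop :=
  (∀ (tag m k : ℕ) (e : Fin k ↪ Fin m) (U : Matrix.unitaryGroup (Fin k → ZMod 2) ℂ),
      IsChannel (N.gate tag m k e U)) ∧
  (∀ (tag m : ℕ) (i : Fin (m + 1)), IsDensity (N.prepare tag m i)) ∧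
  (∀ (tag m : ℕ) (i : Fin (m + 1)),
      (∀ o, (N.measure tag m i o).PosSemidef) ∧ ∑ o, N.measure tag m i o = 1)

/-- Circuit-level stochastic noise of strength `p`: each quantum component `𝒫` is realized by
`(1 - p) 𝒫 + p 𝒩` for some channel `𝒩`. -/
def IsStochasticNoise (p : ℝ) (R : Realization) : Prop :=
  ∃ N : Realization, N.IsPhysical ∧
    (∀ (tag m k : ℕ) (e : Fin k ↪ Fin m) (U : Matrix.unitaryGroup (Fin k → ZMod 2) ℂ),
      R.gate tag m k e U = ((1 - p : ℝ) : ℂ) • ideal.gate tag m k e U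
        + (p : ℂ) • N.gate tag m k e U) ∧
    (∀ (tag m : ℕ) (i : Fin (m + 1)),
      R.prepare tag m i = ((1 - p : ℝ) : ℂ) • ideal.prepare tag m i
        + (p : ℂ) • N.prepare tag m i) ∧
    (∀ (tag m : ℕ) (i : Fin (m + 1)) (o : ZMod 2),
      R.measure tag m i o = ((1 - p : ℝ) : ℂ) • ideal.measure tag m i o
        + (p : ℂ) • N.measure tag m i o)

end Realization

namespace Circuit

/-- The map implemented by a circuit under the realization `R` of its components. -/
noncomputable def run (R : Realization) {out : ℕ} : {m : ℕ} → Circuit out m → (Op m →ₗ[ℂ] Op out)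
  | _, done => LinearMap.id
  | _, gate (m := m) (k := k) tag _ e U next => run R next ∘ₗ actOn e (R.gate tag m k e U)
  | _, prepare (m := m) tag i next => run R next ∘ₗ insertQubit i (R.prepare tag m i)
  | _, measure (m := m) tag i next =>
      ∑ o : ZMod 2, run R (next o) ∘ₗ removeQubit i (R.measure tag m i o)
  | _, random _ w _ _ next => ∑ a, (w a : ℂ) • run R (next a)

/-- Sequential composition `d.after c`: first `c`, then `d`. -/
def after {mid out : ℕ} (d : Circuit out mid) : {m : ℕ} → Circuit mid m → Circuit out m
  | _, done => d
  | _, gate tag hk e U next => gate tag hk e U (after d next)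
  | _, prepare tag i next => prepare tag i (after d next)
  | _, measure tag i next => measure tag i fun o => after d (next o)
  | _, random α w hw hw1 next => random α w hw hw1 fun a => after d (next a)

end Circuit

/-- The layer of `n` single-qubit Pauli gates `i^{aⱼbⱼ} X^{bⱼ} Z^{aⱼ}`, one on each physical qubit
`j` (also where it is the identity), followed by the circuit `rest`; `tag j` is the location of the
gate on qubit `j`. -/
noncomputable def pauliLayer {out n : ℕ} (tag : Fin n → ℕ) (P : PauliLabel n)
    (rest : Circuit out n) : Circuit out n :=
  (List.finRange n).foldr
    (fun j c => Circuit.gate (k := 1) (tag j) (Or.inl rfl)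
      ⟨fun _ => j, fun _ _ _ => Subsingleton.elim _ _⟩
      ⟨pauli (fun _ => P.1 j, fun _ => P.2 j), pauli_mem_unitary _⟩ c) rest

/-! ### Codes with fault-tolerance gadgets -/

/-- A quantum error-correcting code encoding `n` logical qubits into `size` physical qubits,
with a QEC projector and with gadgets (circuits) for error correction and for the logical Pauli
gates that are correct in the absence of noise. -/
structure CodeWithGadgets (n : ℕ) where
  /-- the number of physical qubits -/
  size : ℕ
  /-- the encoding isometry `E` -/
  E : Matrix (Fin size → ZMod 2) (Fin n → ZMod 2) ℂ
  isometry : Eᴴ * E = 1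
  /-- the QEC projector `𝒬`: a channel onto operators on the code space that fixes these -/
  qec : Op size →ₗ[ℂ] Op size
  qec_channel : IsChannel qec
  qec_range : ∀ M, (E * Eᴴ) * qec M * (E * Eᴴ) = qec M
  qec_fixes : ∀ M : Op n, qec (E * M * Eᴴ) = E * M * Eᴴ
  /-- the QEC gadget -/
  qecGadget : Circuit size size
  qecGadget_ideal : qecGadget.run Realization.ideal = qec
  /-- the gadgets for logical Pauli gates -/
  pauliGadget : PauliLabel n → Circuit size size
  pauliGadget_ideal : ∀ (P : PauliLabel n) (M : Op n),
    (pauliGadget P).run Realization.ideal (E * M * Eᴴ) = E * (pauli P * M * (pauli P)ᴴ) * Eᴴ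

namespace CodeWithGadgets

variable {n : ℕ} (C : CodeWithGadgets n)

/-- The ideal encoding channel `ℰ[ρ] = E ρ Eᴴ`. -/
noncomputable def encode : Op n →ₗ[ℂ] Op C.size := sandwich C.E

/-- The ideal logical Pauli gate, as a superoperator: conjugation by `E P Eᴴ`. -/
noncomputable def logicalPauli (P : PauliLabel n) : Op C.size →ₗ[ℂ] Op C.size :=
  sandwich (C.E * pauli P * C.Eᴴ)

/-- An encoding gadget: a circuit that implements `ℰ` in the absence of noise. -/
def IsEncodingGadget (c : Circuit C.size n) : Prop :=
  c.run Realization.ideal = C.encode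

/-- The map `𝒬 ∘ 𝒬̃ ∘ ℰ̃` realized by an encoding gadget followed by a noisy round of error
correction and the ideal projection onto the code space. -/
noncomputable def noisyEncode (R : Realization) (c : Circuit C.size n) : Op n →ₗ[ℂ] Op C.size :=
  C.qec ∘ₗ C.qecGadget.run R ∘ₗ c.run R

/-- The encoding error: the supremum over `n`-qubit states `ρ` of the trace distance between
`𝒬 ∘ 𝒬̃ ∘ ℰ̃ [ρ]` and `ℰ[ρ]`. -/
noncomputable def encodingError (R : Realization) (c : Circuit C.size n) : ℝ :=
  sSup {s : ℝ | ∃ ρ : Op n, IsDensity ρ ∧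
    s = 1 / 2 * traceNorm (C.noisyEncode R c ρ - C.encode ρ)}

/-- The logical error of the gadget for the Pauli gate `P` under the realization `R`:
`½ ‖𝒫̄ ∘ 𝒬 ∘ 𝒬̃ - 𝒬 ∘ 𝒬̃ ∘ 𝒫̃ ∘ 𝒬̃‖` in diamond norm. -/
noncomputable def gateError (R : Realization) (P : PauliLabel n) : ℝ :=
  1 / 2 * diamondNorm
    (C.logicalPauli P ∘ₗ C.qec ∘ₗ C.qecGadget.run R
      - C.qec ∘ₗ C.qecGadget.run R ∘ₗ (C.pauliGadget P).run R ∘ₗ C.qecGadget.run R)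

/-- The logical error suppression function `Γ(ℰ)` at noise strength `p`: the worst logical error
of the Pauli gadgets over all circuit-level stochastic noise of strength `p`. -/
noncomputable def Gam (p : ℝ) : ℝ :=
  sSup {s : ℝ | ∃ R : Realization, R.IsStochasticNoise p ∧ ∃ P : PauliLabel n, s = C.gateError R P}

/-- The Pauli twirl of an encoding gadget: choose a Pauli operator `P` uniformly at random, apply
it to the `n` physical input qubits, run the encoding gadget, then the QEC gadget, then the gadget
for the logical `P`. -/
noncomputable def pauliTwirl (tag : Fin n → ℕ) (c : Circuit C.size n) : Circuit C.size n :=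
  Circuit.random (PauliLabel n) (fun _ => (Fintype.card (PauliLabel n) : ℝ)⁻¹)
    (fun _ => by positivity)
    (by rw [Finset.sum_const, Finset.card_univ, nsmul_eq_mul]; exact mul_inv_cancel₀ (by positivity))
    (fun P => pauliLayer tag P ((C.pauliGadget P).after (C.qecGadget.after c)))

end CodeWithGadgets

/-- A sequence of codes (typically of increasing size) has threshold `p₀`: at every noise strength below `p₀`
the logical error of the Pauli gadgets becomes arbitrarily small far out in the sequence, uniformly
over all circuit-level stochastic noise of that strength. -/
def HasThreshold {n : ℕ} (S : ℕ → CodeWithGadgets n) (p₀ : ℝ) : Prop :=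
  0 < p₀ ∧ ∀ p : ℝ, 0 ≤ p → p < p₀ → ∀ δ : ℝ, 0 < δ → ∃ K : ℕ, ∀ k : ℕ, K ≤ k →
    ∀ R : Realization, R.IsStochasticNoise p → ∀ P : PauliLabel n, (S k).gateError R P ≤ δ

/-! Write ε for the encoding error, F for the physical fidelity and Γ for `Gam p`. Fidelity is lost
in three places, and each loss is bounded separately.

Pauli layer: expand the `n` noisy single-qubit gates. The fault-free branch has weight `(1-p)^n`.
Everything else is a completely positive map, so it adds a nonnegative amount to the fidelity and
can be dropped (`exists_run_pauliLayer_eq`).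

Logical Pauli: in the fault-free branch, correction, noisy gadget and correction are exchanged for
the ideal logical gate after a single correction. The same realization acts in every copy of the QEC
gadget, so the difference is exactly the one measured by `gateError`. A pure-state fidelity sees at
most half of the trace norm of a traceless operator (`two_mul_abs_fidelity_le`), so the cost is Γ,
once.

Twirl: what remains is the decoded noisy encoding conjugated by a uniformly random ideal Pauli.
Outputs of `qec` lie in the code space, so decoding them with `Eᴴ` gives a channel on `n` qubits.
Let `L i` be its Kraus operators. Since the Paulis form a 1-design, Cauchy–Schwarz over the Pauli
group bounds the averaged fidelity below by `4^(-n) ∑ |tr L i|²`, the entanglement fidelity, times F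
(`norm_trace_sq_mul_fidelity_le`). The entanglement fidelity is at least `1 - 2ε`, already because
the computational and the character basis states are each preserved up to ε
(`sum_norm_trace_sq_ge`). Thus ε multiplies F instead of being subtracted from it.

Together these give `(1-p)^n ((1-2ε)F - Γ)`, which is stronger than the claimed bound. The limit of
Γ follows from the uniformity built into the threshold.

The trace norm is defined by singular values, so its duality with contractions is derived first.
Real suprema of unbounded sets are `0` by convention, so using a supremum as an upper bound requires
a boundedness proof each time. -/

/-! ### Squared norms, contractions and the trace norm -/

/-- The squared Euclidean norm of a vector. -/
noncomputable def normSq {a : Type} [Fintype a] (v : a → ℂ) : ℝ := ∑ i, ‖v i‖ ^ 2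

theorem normSq_nonneg {a : Type} [Fintype a] (v : a → ℂ) : 0 ≤ normSq v :=
  Finset.sum_nonneg fun _ _ => sq_nonneg _

theorem star_dotProduct_self {a : Type} [Fintype a] (v : a → ℂ) :
    star v ⬝ᵥ v = (normSq v : ℂ) := by
  simp [dotProduct, normSq, Complex.conj_mul']

theorem star_mulVec_dotProduct {a b : Type} [Fintype a] [Fintype b] (A : Matrix b a ℂ)
    (v : a → ℂ) (w : b → ℂ) : star (A *ᵥ v) ⬝ᵥ w = star v ⬝ᵥ (Aᴴ *ᵥ w) := by
  rw [Matrix.star_mulVec, Matrix.dotProduct_mulVec]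

theorem normSq_mulVec {a b : Type} [Fintype a] [Fintype b] (A : Matrix b a ℂ) (v : a → ℂ) :
    (normSq (A *ᵥ v) : ℂ) = star v ⬝ᵥ ((Aᴴ * A) *ᵥ v) := by
  rw [← star_dotProduct_self, star_mulVec_dotProduct, Matrix.mulVec_mulVec]

theorem normSq_mulVec_of_isometry {a b : Type} [Fintype a] [DecidableEq a] [Fintype b]
    {A : Matrix b a ℂ} (h : Aᴴ * A = 1) (v : a → ℂ) : normSq (A *ᵥ v) = normSq v := by
  have := normSq_mulVec A v
  rw [h, Matrix.one_mulVec, star_dotProduct_self] at this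
  exact_mod_cast this

/-- Cauchy–Schwarz for the whole family regarded as one long vector indexed by `ι × a`, so that all
Kraus operators are handled at once. -/
theorem norm_sum_star_dotProduct_le {ι a : Type} [Fintype ι] [Fintype a] (u w : ι → a → ℂ) :
    ‖∑ i, star (u i) ⬝ᵥ w i‖ ≤ √(∑ i, normSq (u i)) * √(∑ i, normSq (w i)) := by
  have h : ‖∑ i, star (u i) ⬝ᵥ w i‖ ≤ ∑ x : ι × a, ‖u x.1 x.2‖ * ‖w x.1 x.2‖ := by
    rw [Fintype.sum_prod_type]
    refine (norm_sum_le _ _).trans (Finset.sum_le_sum fun i _ => ?_)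
    refine (norm_sum_le _ _).trans (Finset.sum_le_sum fun j _ => ?_)
    simp
  refine h.trans ((Real.sum_mul_le_sqrt_mul_sqrt _ _ _).trans_eq ?_)
  simp only [Fintype.sum_prod_type, normSq]

/-- A unitary of right singular vectors computes the trace norm. -/
theorem exists_singular_unitary {a : Type} [Fintype a] [DecidableEq a] (M : Matrix a a ℂ) :
    ∃ (V : Matrix a a ℂ) (s : a → ℝ), Vᴴ * V = 1 ∧ V * Vᴴ = 1 ∧ (∀ j, 0 ≤ s j) ∧
      Mᴴ * M = V * Matrix.diagonal (fun j => ((s j : ℂ)) ^ 2) * Vᴴ ∧ traceNorm M = ∑ j, s j := by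
  set hM := Matrix.isHermitian_conjTranspose_mul_self M
  refine ⟨hM.eigenvectorUnitary, fun j => √(hM.eigenvalues j),
    Matrix.mem_unitaryGroup_iff'.1 hM.eigenvectorUnitary.2,
    Matrix.mem_unitaryGroup_iff.1 hM.eigenvectorUnitary.2, fun j => Real.sqrt_nonneg _, ?_, rfl⟩
  have h := hM.spectral_theorem
  rw [Unitary.conjStarAlgAut_apply] at h
  have h2 : (fun j => ((√(hM.eigenvalues j) : ℝ) : ℂ) ^ 2) = RCLike.ofReal ∘ hM.eigenvalues := by
    funext j
    have := (Matrix.posSemidef_conjTranspose_mul_self M).eigenvalues_nonneg j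
    rw [← Complex.ofReal_pow, Real.sq_sqrt this]
    rfl
  rw [h2]
  exact h

theorem traceNorm_nonneg {a : Type} [Fintype a] [DecidableEq a] (M : Matrix a a ℂ) :
    0 ≤ traceNorm M :=
  Finset.sum_nonneg fun _ _ => Real.sqrt_nonneg _

/-- Hölder's inequality for the trace norm, with a channel in Kraus form inserted. -/
theorem norm_trace_mul_kraus_le {ι a b : Type} [Fintype ι] [Fintype a] [DecidableEq a] [Fintype b]
    (K : ι → Matrix b a ℂ) (hK : ∑ i, (K i)ᴴ * K i = 1) (W : Matrix b b ℂ)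
    (hW : ∀ v, normSq (Wᴴ *ᵥ v) ≤ normSq v) (M : Matrix a a ℂ) :
    ‖(W * ∑ i, K i * M * (K i)ᴴ).trace‖ ≤ traceNorm M := by
  obtain ⟨V, s, hV, hV', hs, hM, hn⟩ := exists_singular_unitary M
  -- Trace preservation says that the stacked Kraus operators form an isometry.
  have hKn : ∀ v, ∑ i, normSq (K i *ᵥ v) = normSq v := by
    intro v
    have : ((∑ i, normSq (K i *ᵥ v) : ℝ) : ℂ) = normSq v := by
      push_cast
      simp_rw [normSq_mulVec]
      rw [← dotProduct_sum, ← Matrix.sum_mulVec, hK, Matrix.one_mulVec, star_dotProduct_self]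
    exact_mod_cast this
  have hcol : ∀ j, V.col j = V *ᵥ Pi.single j 1 := fun j => by simp
  have hVj : ∀ j, normSq (V.col j) = 1 := by
    intro j
    rw [hcol, normSq_mulVec_of_isometry hV]
    simp [normSq, Pi.single_apply, apply_ite]
  have hMj : ∀ j, normSq (M *ᵥ V.col j) = s j ^ 2 := by
    intro j
    have h : (normSq (M *ᵥ V.col j) : ℂ) = ((s j ^ 2 : ℝ) : ℂ) := by
      rw [normSq_mulVec, hM, hcol, star_mulVec_dotProduct, Matrix.mulVec_mulVec,
        Matrix.mulVec_mulVec]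
      have : Vᴴ * (V * Matrix.diagonal (fun j => ((s j : ℂ)) ^ 2) * Vᴴ) * V
          = Matrix.diagonal (fun j => ((s j : ℂ)) ^ 2) := by
        rw [Matrix.mul_assoc, Matrix.mul_assoc _ Vᴴ, hV, Matrix.mul_one, ← Matrix.mul_assoc, hV, Matrix.one_mul]
      rw [this, Matrix.mulVec_single_one]
      simp [dotProduct, Pi.single_apply, Matrix.diagonal_apply]
    exact_mod_cast h
  -- The trace is evaluated in the right singular basis, where `M` stretches the `j`-th vector by `s
  -- j`; each `j` then contributes at most `s j`.
  have htr : (W * ∑ i, K i * M * (K i)ᴴ).trace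
      = ∑ j, ∑ i, star (Wᴴ *ᵥ (K i *ᵥ V.col j)) ⬝ᵥ (K i *ᵥ (M *ᵥ V.col j)) := by
    have h1 : (W * ∑ i, K i * M * (K i)ᴴ).trace
        = (Vᴴ * (∑ i, (K i)ᴴ * (W * (K i * M))) * V).trace := by
      rw [Matrix.trace_mul_comm (Vᴴ * _), ← Matrix.mul_assoc, hV', Matrix.one_mul, Matrix.mul_sum,
        Matrix.trace_sum, Matrix.trace_sum]
      refine Finset.sum_congr rfl fun i _ => ?_
      rw [← Matrix.mul_assoc, Matrix.trace_mul_comm]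
    rw [h1, Matrix.trace]
    refine Finset.sum_congr rfl fun j _ => ?_
    have h2 : ∀ A : Matrix a a ℂ, (Vᴴ * A * V).diag j = star (V.col j) ⬝ᵥ (A *ᵥ V.col j) := by
      intro A
      rw [hcol, star_mulVec_dotProduct, Matrix.mulVec_mulVec, Matrix.mulVec_mulVec,
        Matrix.mulVec_single_one]
      simp [dotProduct, Pi.single_apply, apply_ite]
    rw [h2, Matrix.sum_mulVec, dotProduct_sum]
    refine Finset.sum_congr rfl fun i _ => ?_
    rw [star_mulVec_dotProduct, star_mulVec_dotProduct, Matrix.conjTranspose_conjTranspose]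
    simp only [Matrix.mulVec_mulVec]
  rw [htr, hn]
  refine (norm_sum_le _ _).trans (Finset.sum_le_sum fun j _ => ?_)
  refine (norm_sum_star_dotProduct_le _ _).trans ?_
  rw [hKn, hMj, Real.sqrt_sq (hs j)]
  have : √(∑ i, normSq (Wᴴ *ᵥ (K i *ᵥ V.col j))) ≤ 1 := by
    refine Real.sqrt_le_one.2 ?_
    exact (Finset.sum_le_sum fun i _ => hW _).trans_eq ((hKn _).trans (hVj j))
  exact mul_le_of_le_one_left (hs j) this

theorem norm_trace_mul_le {a : Type} [Fintype a] [DecidableEq a] (W : Matrix a a ℂ)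
    (hW : ∀ v, normSq (Wᴴ *ᵥ v) ≤ normSq v) (M : Matrix a a ℂ) :
    ‖(W * M).trace‖ ≤ traceNorm M := by
  simpa using norm_trace_mul_kraus_le (ι := Unit) (fun _ => (1 : Matrix a a ℂ)) (by simp) W hW M

/-- The trace norm is attained on a contraction. -/
theorem exists_trace_mul_eq_traceNorm {a : Type} [Fintype a] [DecidableEq a] (M : Matrix a a ℂ) :
    ∃ W : Matrix a a ℂ, (∀ v, normSq (Wᴴ *ᵥ v) ≤ normSq v) ∧ (W * M).trace = (traceNorm M : ℂ) := by
  obtain ⟨V, s, hV, hV', hs, hM, hn⟩ := exists_singular_unitary M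
  -- Because `0⁻¹ = 0`, this is a pseudo-inverse. The witness `V D Vᴴ Mᴴ` is the adjoint of the
  -- polar part of `M`, so multiplying it by `M` gives `|M|`.
  set D : Matrix a a ℂ := Matrix.diagonal fun j => ((s j : ℂ))⁻¹
  have hD : Dᴴ = D := by
    rw [Matrix.diagonal_conjTranspose]
    congr 1
    funext j
    simp
  have key : V * D * Vᴴ * Mᴴ * M = V * Matrix.diagonal (fun j => (s j : ℂ)) * Vᴴ := by
    rw [Matrix.mul_assoc _ Mᴴ, hM]
    have : V * D * Vᴴ * (V * Matrix.diagonal (fun j => (s j : ℂ) ^ 2) * Vᴴ)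
        = V * (D * (Vᴴ * V) * Matrix.diagonal (fun j => (s j : ℂ) ^ 2)) * Vᴴ := by
      simp only [Matrix.mul_assoc]
    rw [this, hV, Matrix.mul_one, Matrix.diagonal_mul_diagonal]
    congr 3
    funext j
    by_cases h : (s j : ℂ) = 0
    · simp [h]
    · field_simp
  refine ⟨V * D * Vᴴ * Mᴴ, fun v => ?_, ?_⟩
  · have h1 : (V * D * Vᴴ * Mᴴ)ᴴ = M * V * D * Vᴴ := by
      simp [Matrix.conjTranspose_mul, hD, Matrix.mul_assoc]
    set u := Vᴴ *ᵥ v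
    have hu : normSq u = normSq v := normSq_mulVec_of_isometry (by simpa using hV') v
    -- The columns of `M V D` are orthonormal where `s j ≠ 0` and vanish elsewhere: a partial
    -- isometry.
    have h2 : (M * V * D)ᴴ * (M * V * D) = Matrix.diagonal fun j => if s j = 0 then (0 : ℂ) else 1 := by
      have : (M * V * D)ᴴ * (M * V * D)
          = D * (Vᴴ * (V * Matrix.diagonal (fun j => (s j : ℂ) ^ 2) * Vᴴ) * V) * D := by
        rw [← hM]
        simp [Matrix.conjTranspose_mul, hD, Matrix.mul_assoc]
      rw [this, Matrix.mul_assoc Vᴴ, Matrix.mul_assoc _ Vᴴ, hV, Matrix.mul_one, ← Matrix.mul_assoc Vᴴ,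
        hV, Matrix.one_mul, Matrix.diagonal_mul_diagonal, Matrix.diagonal_mul_diagonal]
      congr 1
      funext j
      by_cases h : s j = 0
      · simp [h]
      · have : (s j : ℂ) ≠ 0 := by exact_mod_cast h
        simp only [h, if_false]
        field_simp
    have h3 : normSq ((M * V * D) *ᵥ u) = ∑ j, if s j = 0 then 0 else ‖u j‖ ^ 2 := by
      have h := normSq_mulVec (M * V * D) u
      rw [h2] at h
      have h4 : star u ⬝ᵥ ((Matrix.diagonal fun j => if s j = 0 then (0 : ℂ) else 1) *ᵥ u)
          = ((∑ j, if s j = 0 then 0 else ‖u j‖ ^ 2 : ℝ) : ℂ) := by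
        push_cast
        rw [dotProduct]
        refine Finset.sum_congr rfl fun j _ => ?_
        rw [Matrix.mulVec_diagonal]
        split_ifs <;> simp [Complex.conj_mul']
      exact_mod_cast h.trans h4
    rw [h1, ← Matrix.mulVec_mulVec, h3, ← hu]
    refine Finset.sum_le_sum fun j _ => ?_
    split_ifs
    · positivity
    · exact le_rfl
  · rw [key, Matrix.trace_mul_comm, ← Matrix.mul_assoc, hV, Matrix.one_mul, hn]
    simp [Matrix.trace]

theorem traceNorm_sub_le {a : Type} [Fintype a] [DecidableEq a] (M N : Matrix a a ℂ) :
    traceNorm (M - N) ≤ traceNorm M + traceNorm N := by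
  obtain ⟨W, hW, h⟩ := exists_trace_mul_eq_traceNorm (M - N)
  have h' : traceNorm (M - N) = ‖(W * (M - N)).trace‖ := by
    rw [h, Complex.norm_of_nonneg (traceNorm_nonneg _)]
  rw [h', Matrix.mul_sub, Matrix.trace_sub]
  exact (norm_sub_le _ _).trans (add_le_add (norm_trace_mul_le W hW M) (norm_trace_mul_le W hW N))

/-- The contraction attaining the output norm is used as test operator in Hölder's inequality for
the input. -/
theorem traceNorm_kraus_le {ι a b : Type} [Fintype ι] [Fintype a] [DecidableEq a] [Fintype b]
    [DecidableEq b] (K : ι → Matrix b a ℂ) (hK : ∑ i, (K i)ᴴ * K i = 1) (M : Matrix a a ℂ) :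
    traceNorm (∑ i, K i * M * (K i)ᴴ) ≤ traceNorm M := by
  obtain ⟨W, hW, h⟩ := exists_trace_mul_eq_traceNorm (∑ i, K i * M * (K i)ᴴ)
  have := norm_trace_mul_kraus_le K hK W hW M
  rwa [h, Complex.norm_of_nonneg (traceNorm_nonneg _)] at this

open Matrix in
theorem Matrix.PosSemidef.exists_eq_conjTranspose_mul_self {a : Type} [Fintype a] [DecidableEq a]
    {M : Matrix a a ℂ} (hM : M.PosSemidef) : ∃ B : Matrix a a ℂ, M = Bᴴ * B := by
  open scoped MatrixOrder in
  obtain ⟨B, hB⟩ := CStarAlgebra.nonneg_iff_eq_star_mul_self.1 hM.nonneg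
  exact ⟨B, hB⟩

/-- For `M = Bᴴ B`, pairing with a contraction is a sum of inner products of columns of `Bᴴ`;
Cauchy–Schwarz bounds it by their squared norms, which add up to the trace. -/
theorem traceNorm_le_trace {a : Type} [Fintype a] [DecidableEq a] {M : Matrix a a ℂ}
    (hM : M.PosSemidef) : traceNorm M ≤ M.trace.re := by
  obtain ⟨W, hW, h⟩ := exists_trace_mul_eq_traceNorm M
  obtain ⟨B, rfl⟩ := hM.exists_eq_conjTranspose_mul_self
  have e : ∀ i, (Bᴴ).col i = star (B i) := fun i => by ext; simp
  have h1 : (W * (Bᴴ * B)).trace = ∑ i, star (Wᴴ *ᵥ Bᴴ.col i) ⬝ᵥ Bᴴ.col i := by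
    rw [← Matrix.mul_assoc, Matrix.trace_mul_comm]
    refine Finset.sum_congr rfl fun i _ => ?_
    rw [star_mulVec_dotProduct, Matrix.conjTranspose_conjTranspose, e, star_star]
    simp [Matrix.mul_apply, dotProduct, Matrix.mulVec, Finset.mul_sum]
  have h2 : (Bᴴ * B).trace = ((∑ i, normSq (Bᴴ.col i) : ℝ) : ℂ) := by
    rw [Matrix.trace_mul_comm]
    push_cast
    refine Finset.sum_congr rfl fun i _ => ?_
    rw [← star_dotProduct_self, e, star_star]
    simp [Matrix.mul_apply, dotProduct]
  have h3 : traceNorm (Bᴴ * B) = ‖(W * (Bᴴ * B)).trace‖ := by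
    rw [h, Complex.norm_of_nonneg (traceNorm_nonneg _)]
  rw [h3, h1, h2, Complex.ofReal_re]
  have hs : 0 ≤ ∑ i, normSq (Bᴴ.col i) := Finset.sum_nonneg fun _ _ => normSq_nonneg _
  refine (norm_sum_star_dotProduct_le _ _).trans ?_
  calc _ ≤ √(∑ i, normSq (Bᴴ.col i)) * √(∑ i, normSq (Bᴴ.col i)) := by
        gcongr
        exact hW _
    _ = _ := Real.mul_self_sqrt hs

/-- A unit vector detects at most half of the trace norm of a traceless matrix. -/
theorem two_mul_abs_fidelity_le {a : Type} [Fintype a] [DecidableEq a] {v : a → ℂ}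
    (hv : normSq v = 1) {X : Matrix a a ℂ} (hX : X.trace = 0) :
    2 * |fidelity v X| ≤ traceNorm X := by
  -- The reflection in `v` is unitary, and on a traceless matrix only its rank-one part contributes
  -- to the trace. This is the source of the factor 2.
  set W : Matrix a a ℂ := 1 - (2 : ℂ) • Matrix.vecMulVec v (star v) with hWdef
  have hvv : Matrix.vecMulVec v (star v) * Matrix.vecMulVec v (star v)
      = Matrix.vecMulVec v (star v) := by
    rw [Matrix.vecMulVec_mul_vecMulVec, star_dotProduct_self, hv]
    simp
  have hWh : Wᴴ = W := by
    simp [W, Matrix.conjTranspose_sub, Matrix.conjTranspose_smul, Matrix.conjTranspose_vecMulVec]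
  have hW2 : W * W = 1 := by
    simp only [W, Matrix.sub_mul, Matrix.mul_sub, Matrix.one_mul, Matrix.mul_one,
      Matrix.smul_mul, Matrix.mul_smul, hvv]
    module
  have h := norm_trace_mul_le W (fun u => by
    rw [normSq_mulVec_of_isometry (by rw [hWh, hWh, hW2])]) X
  have ht : (W * X).trace = -2 * (star v ⬝ᵥ (X *ᵥ v)) := by
    rw [hWdef, Matrix.sub_mul, Matrix.one_mul, Matrix.trace_sub, hX, Matrix.smul_mul,
      Matrix.trace_smul, Matrix.vecMulVec_mul, Matrix.trace_vecMulVec, dotProduct_comm,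
      Matrix.dotProduct_mulVec]
    simp
  rw [ht, norm_mul] at h
  simp only [norm_neg, Complex.norm_ofNat] at h
  exact (mul_le_mul_of_nonneg_left (Complex.abs_re_le_norm _) two_pos.le).trans h

/-! ### Completely positive maps in Kraus form -/

/-- Complete positivity, in Kraus form. -/
def IsCP {a b : Type} [Fintype a] (Φ : Matrix a a ℂ →ₗ[ℂ] Matrix b b ℂ) : Prop :=
  ∃ (ι : Type) (_ : Fintype ι) (K : ι → Matrix b a ℂ), ∀ M, Φ M = ∑ i, K i * M * (K i)ᴴ

/-- Trace preservation. -/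
def IsTP {a b : Type} [Fintype a] [Fintype b] (Φ : Matrix a a ℂ →ₗ[ℂ] Matrix b b ℂ) : Prop :=
  ∀ M, (Φ M).trace = M.trace

theorem isCP_sandwich {a b : Type} [Fintype a] (K : Matrix b a ℂ) : IsCP (sandwich K) :=
  ⟨Unit, inferInstance, fun _ => K, fun M => by simp [sandwich]⟩

theorem isTP_sandwich {a b : Type} [Fintype a] [DecidableEq a] [Fintype b] {K : Matrix b a ℂ}
    (hK : Kᴴ * K = 1) : IsTP (sandwich K) := fun M => by
  change (K * M * Kᴴ).trace = _
  rw [Matrix.trace_mul_comm, ← Matrix.mul_assoc, hK, Matrix.one_mul]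

theorem IsTP.comp {a b c : Type} [Fintype a] [Fintype b] [Fintype c]
    {Ψ : Matrix b b ℂ →ₗ[ℂ] Matrix c c ℂ} {Φ : Matrix a a ℂ →ₗ[ℂ] Matrix b b ℂ}
    (hΨ : IsTP Ψ) (hΦ : IsTP Φ) : IsTP (Ψ ∘ₗ Φ) := fun M => (hΨ _).trans (hΦ M)

namespace IsCP

variable {a b c : Type} [Fintype a]

theorem comp [Fintype b] {Ψ : Matrix b b ℂ →ₗ[ℂ] Matrix c c ℂ} {Φ : Matrix a a ℂ →ₗ[ℂ] Matrix b b ℂ}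
    (hΨ : IsCP Ψ) (hΦ : IsCP Φ) : IsCP (Ψ ∘ₗ Φ) := by
  obtain ⟨ι, _, K, hK⟩ := hΨ
  obtain ⟨κ, _, L, hL⟩ := hΦ
  refine ⟨ι × κ, inferInstance, fun x => K x.1 * L x.2, fun M => ?_⟩
  rw [LinearMap.comp_apply, hK, Fintype.sum_prod_type]
  refine Finset.sum_congr rfl fun i _ => ?_
  rw [hL, Matrix.mul_sum, Matrix.sum_mul]
  refine Finset.sum_congr rfl fun j _ => ?_
  simp only [Matrix.conjTranspose_mul, Matrix.mul_assoc]

theorem id [DecidableEq a] : IsCP (LinearMap.id : Matrix a a ℂ →ₗ[ℂ] Matrix a a ℂ) :=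
  ⟨Unit, inferInstance, fun _ => 1, fun M => by simp⟩

theorem zero : IsCP (0 : Matrix a a ℂ →ₗ[ℂ] Matrix b b ℂ) :=
  ⟨Empty, inferInstance, fun _ => 0, fun M => by simp⟩

theorem add {Φ Ψ : Matrix a a ℂ →ₗ[ℂ] Matrix b b ℂ} (hΦ : IsCP Φ) (hΨ : IsCP Ψ) :
    IsCP (Φ + Ψ) := by
  obtain ⟨ι, _, K, hK⟩ := hΦ
  obtain ⟨κ, _, L, hL⟩ := hΨ
  exact ⟨ι ⊕ κ, inferInstance, Sum.elim K L, fun M => by simp [hK, hL]⟩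

theorem smul {Φ : Matrix a a ℂ →ₗ[ℂ] Matrix b b ℂ} (hΦ : IsCP Φ) {r : ℝ} (hr : 0 ≤ r) :
    IsCP ((r : ℂ) • Φ) := by
  obtain ⟨ι, _, K, hK⟩ := hΦ
  refine ⟨ι, inferInstance, fun i => ((√r : ℝ) : ℂ) • K i, fun M => ?_⟩
  rw [LinearMap.smul_apply, hK, Finset.smul_sum]
  refine Finset.sum_congr rfl fun i _ => ?_
  simp [Matrix.conjTranspose_smul, smul_smul, Real.mul_self_sqrt hr]

theorem sum {ι : Type} (s : Finset ι) {Φ : ι → Matrix a a ℂ →ₗ[ℂ] Matrix b b ℂ}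
    (h : ∀ i ∈ s, IsCP (Φ i)) : IsCP (∑ i ∈ s, Φ i) := by
  classical
  induction s using Finset.induction_on with
  | empty => simpa using zero
  | insert i s hi ih =>
    rw [Finset.sum_insert hi]
    exact (h i (Finset.mem_insert_self _ _)).add
      (ih fun j hj => h j (Finset.mem_insert_of_mem hj))

theorem posSemidef [Fintype b] {Φ : Matrix a a ℂ →ₗ[ℂ] Matrix b b ℂ} (hΦ : IsCP Φ) {M : Matrix a a ℂ}
    (hM : M.PosSemidef) : (Φ M).PosSemidef := by
  obtain ⟨ι, _, K, hK⟩ := hΦ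
  rw [hK]
  exact Matrix.posSemidef_sum _ fun i _ => hM.mul_mul_conjTranspose_same (K i)

end IsCP

/-- Trace preservation determines this sum because the trace pairing is nondegenerate. -/
theorem sum_conjTranspose_mul_eq_one {ι a b : Type} [Fintype ι] [Fintype a] [DecidableEq a]
    [Fintype b] {Φ : Matrix a a ℂ →ₗ[ℂ] Matrix b b ℂ} (hΦ : IsTP Φ) {K : ι → Matrix b a ℂ}
    (hK : ∀ M, Φ M = ∑ i, K i * M * (K i)ᴴ) : ∑ i, (K i)ᴴ * K i = 1 := by
  rw [Matrix.ext_iff_trace_mul_left]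
  intro M
  rw [Matrix.mul_one, ← hΦ M, hK, Matrix.mul_sum, Matrix.trace_sum, Matrix.trace_sum]
  refine Finset.sum_congr rfl fun i _ => ?_
  rw [Matrix.trace_mul_comm (K i * M), ← Matrix.mul_assoc (K i)ᴴ, Matrix.trace_mul_comm M]

/-- The Choi–Kraus theorem. -/
theorem IsChannel.isCP {a b : Type} [Fintype a] [Fintype b]
    {Φ : Matrix a a ℂ →ₗ[ℂ] Matrix b b ℂ} (hΦ : IsChannel Φ) : IsCP Φ := by
  classical
  set e := Fintype.equivFin a
  -- The unnormalized maximally entangled vector: the ampliated map sends its projector to the Choi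
  -- matrix, and the rows of a factor `B` of that matrix supply the Kraus operators.
  set w : a × Fin (Fintype.card a) → ℂ := fun x => if e x.1 = x.2 then 1 else 0
  obtain ⟨B, hB⟩ := (hΦ.1 _ _ (Matrix.posSemidef_vecMulVec_self_star w)).exists_eq_conjTranspose_mul_self
  have hentry : ∀ (u v : a) (x y : b),
      Φ (Matrix.single u v 1) x y = ∑ r, star (B r (x, e u)) * B r (y, e v) := by
    intro u v x y
    have h := congrFun (congrFun hB (x, e u)) (y, e v)
    rw [Matrix.mul_apply] at h
    rw [← show _ = ∑ r, star (B r (x, e u)) * B r (y, e v) from h]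
    simp only [ampliation, Matrix.of_apply]
    refine congrArg (fun A => Φ A x y) ?_
    ext i j
    by_cases h1 : u = i <;> by_cases h2 : v = j <;>
      simp [w, Matrix.vecMulVec_apply, h1, h2, eq_comm (a := i) (b := u),
        eq_comm (a := j) (b := v)]
  refine ⟨b × Fin (Fintype.card a), inferInstance,
    fun r => Matrix.of fun x u => star (B r (x, e u)), fun M => ?_⟩
  have hM : Φ M = ∑ u, ∑ v, M u v • Φ (Matrix.single u v 1) := by
    conv_lhs => rw [Matrix.matrix_eq_sum_single M]
    simp only [map_sum]
    refine Finset.sum_congr rfl fun u _ => Finset.sum_congr rfl fun v _ => ?_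
    rw [← map_smul, Matrix.smul_single, smul_eq_mul, mul_one]
  ext x y
  rw [hM]
  simp only [Matrix.sum_apply, Matrix.smul_apply, hentry, smul_eq_mul, Matrix.mul_apply,
    Matrix.of_apply, Matrix.conjTranspose_apply, star_star, Finset.mul_sum, Finset.sum_mul]
  calc _ = ∑ v, ∑ u, ∑ r, M u v * (star (B r (x, e u)) * B r (y, e v)) := Finset.sum_comm
    _ = ∑ v, ∑ r, ∑ u, M u v * (star (B r (x, e u)) * B r (y, e v)) :=
      Finset.sum_congr rfl fun _ _ => Finset.sum_comm
    _ = ∑ r, ∑ v, ∑ u, M u v * (star (B r (x, e u)) * B r (y, e v)) := Finset.sum_comm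
    _ = _ := by
      refine Finset.sum_congr rfl fun r _ => Finset.sum_congr rfl fun v _ =>
        Finset.sum_congr rfl fun u _ => ?_
      ring

/-! ### Norms of ampliated channels -/

theorem traceNorm_ampliation_le {a b : Type} [Fintype a] [DecidableEq a] [Fintype b]
    [DecidableEq b] {Φ : Matrix a a ℂ →ₗ[ℂ] Matrix b b ℂ} (hΦ : IsCP Φ) (hΦ' : IsTP Φ) (r : ℕ)
    (M : Matrix (a × Fin r) (a × Fin r) ℂ) : traceNorm (ampliation r Φ M) ≤ traceNorm M := by
  obtain ⟨ι, _, K, hK⟩ := hΦ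
  have h1 := sum_conjTranspose_mul_eq_one hΦ' hK
  set L : ι → Matrix (b × Fin r) (a × Fin r) ℂ := fun i =>
    Matrix.kroneckerMap (· * ·) (K i) (1 : Matrix (Fin r) (Fin r) ℂ)
  have hL : ∑ i, (L i)ᴴ * L i = 1 := by
    have h2 : ∀ i, (L i)ᴴ * L i
        = Matrix.kroneckerMap (· * ·) ((K i)ᴴ * K i) (1 : Matrix (Fin r) (Fin r) ℂ) := by
      intro i
      rw [Matrix.conjTranspose_kronecker, ← Matrix.mul_kronecker_mul]
      simp
    rw [← Matrix.one_kronecker_one (α := ℂ) (m := a) (n := Fin r), ← h1]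
    ext x y
    simp [h2, Matrix.sum_apply, Finset.sum_mul, Matrix.kroneckerMap_apply]
  have hM : ampliation r Φ M = ∑ i, L i * M * (L i)ᴴ := by
    ext x y
    simp only [ampliation, hK, Matrix.of_apply, Matrix.sum_apply]
    refine Finset.sum_congr rfl fun i _ => ?_
    simp [L, Matrix.mul_apply, Fintype.sum_prod_type, Matrix.one_apply, Matrix.kroneckerMap_apply,
      apply_ite (starRingEnd ℂ)]
  rw [hM]
  exact traceNorm_kraus_le L hL M

theorem traceNorm_channel_le {a b : Type} [Fintype a] [DecidableEq a] [Fintype b]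
    [DecidableEq b] {Φ : Matrix a a ℂ →ₗ[ℂ] Matrix b b ℂ} (hΦ : IsCP Φ) (hΦ' : IsTP Φ)
    (M : Matrix a a ℂ) : traceNorm (Φ M) ≤ traceNorm M := by
  obtain ⟨ι, _, K, hK⟩ := hΦ
  rw [hK]
  exact traceNorm_kraus_le K (sum_conjTranspose_mul_eq_one hΦ' hK) M

theorem ampliation_sub {a b : Type} (r : ℕ) (Φ Ψ : Matrix a a ℂ →ₗ[ℂ] Matrix b b ℂ)
    (M : Matrix (a × Fin r) (a × Fin r) ℂ) :
    ampliation r (Φ - Ψ) M = ampliation r Φ M - ampliation r Ψ M := rfl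

theorem traceNorm_ampliation_sub_le {a b : Type} [Fintype a] [DecidableEq a] [Fintype b]
    [DecidableEq b] {Φ Ψ : Matrix a a ℂ →ₗ[ℂ] Matrix b b ℂ} (hΦ : IsCP Φ) (hΦ' : IsTP Φ)
    (hΨ : IsCP Ψ) (hΨ' : IsTP Ψ) (r : ℕ) {M : Matrix (a × Fin r) (a × Fin r) ℂ}
    (hM : traceNorm M ≤ 1) : traceNorm (ampliation r (Φ - Ψ) M) ≤ 2 := by
  rw [ampliation_sub]
  have h1 := traceNorm_ampliation_le hΦ hΦ' r M
  have h2 := traceNorm_ampliation_le hΨ hΨ' r M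
  linarith [traceNorm_sub_le (ampliation r Φ M) (ampliation r Ψ M)]

theorem diamondNorm_nonneg {a b : Type} [Fintype a] [DecidableEq a] [Fintype b] [DecidableEq b]
    (Φ : Matrix a a ℂ →ₗ[ℂ] Matrix b b ℂ) : 0 ≤ diamondNorm Φ :=
  Real.sSup_nonneg (by rintro _ ⟨r, M, -, rfl⟩; exact traceNorm_nonneg _)

theorem diamondNorm_sub_le_two {a b : Type} [Fintype a] [DecidableEq a] [Fintype b]
    [DecidableEq b] {Φ Ψ : Matrix a a ℂ →ₗ[ℂ] Matrix b b ℂ} (hΦ : IsCP Φ) (hΦ' : IsTP Φ)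
    (hΨ : IsCP Ψ) (hΨ' : IsTP Ψ) : diamondNorm (Φ - Ψ) ≤ 2 :=
  Real.sSup_le (by
    rintro _ ⟨r, M, hM, rfl⟩
    exact traceNorm_ampliation_sub_le hΦ hΦ' hΨ hΨ' r hM) two_pos.le

/-- On a state, the outputs of two channels differ in the fidelity with a pure state by at most
half of the diamond distance. -/
theorem two_mul_abs_fidelity_sub_le_diamondNorm {a b : Type} [Fintype a] [DecidableEq a]
    [Fintype b] [DecidableEq b] {Φ Ψ : Matrix a a ℂ →ₗ[ℂ] Matrix b b ℂ} (hΦ : IsCP Φ)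
    (hΦ' : IsTP Φ) (hΨ : IsCP Ψ) (hΨ' : IsTP Ψ) {v : b → ℂ} (hv : normSq v = 1)
    {ρ : Matrix a a ℂ} (hρ : IsDensity ρ) :
    2 * |fidelity v ((Φ - Ψ) ρ)| ≤ diamondNorm (Φ - Ψ) := by
  -- A one-dimensional reference system suffices, since the input is a single state.
  set M : Matrix (a × Fin 1) (a × Fin 1) ℂ := ρ.submatrix Prod.fst Prod.fst with hMdef
  have hMp : M.PosSemidef := hρ.1.submatrix _
  have hMt : M.trace = 1 := by
    rw [← hρ.2]
    simp [Matrix.trace, M, Fintype.sum_prod_type]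
  have hM : traceNorm M ≤ 1 := (traceNorm_le_trace hMp).trans (by simp [hMt])
  have hA : ampliation 1 (Φ - Ψ) M = ((Φ - Ψ) ρ).submatrix Prod.fst Prod.fst := rfl
  set w : b × Fin 1 → ℂ := fun x => v x.1
  have hw : normSq w = 1 := by
    rw [← hv]
    simp [normSq, w, Fintype.sum_prod_type]
  have hf : fidelity w (ampliation 1 (Φ - Ψ) M) = fidelity v ((Φ - Ψ) ρ) := by
    rw [hA]
    simp [fidelity, w, dotProduct, Matrix.mulVec, Fintype.sum_prod_type]
  have ht : (ampliation 1 (Φ - Ψ) M).trace = 0 := by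
    have : (ampliation 1 (Φ - Ψ) M).trace = ((Φ - Ψ) ρ).trace := by
      rw [hA]
      simp [Matrix.trace, Fintype.sum_prod_type]
    rw [this, LinearMap.sub_apply, Matrix.trace_sub, hΦ', hΨ', sub_self]
  rw [← hf]
  refine (two_mul_abs_fidelity_le hw ht).trans (le_csSup ⟨2, ?_⟩ ⟨1, M, hM, rfl⟩)
  rintro _ ⟨r, M, hM, rfl⟩
  exact traceNorm_ampliation_sub_le hΦ hΦ' hΨ hΨ' r hM

/-! ### Positivity, linearity and covariance of the fidelity -/

theorem fidelity_nonneg {a : Type} [Fintype a] (v : a → ℂ) {M : Matrix a a ℂ}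
    (hM : M.PosSemidef) : 0 ≤ fidelity v M :=
  (Complex.le_def.1 (hM.dotProduct_mulVec_nonneg v)).1

theorem fidelity_add {a : Type} [Fintype a] (v : a → ℂ) (M N : Matrix a a ℂ) :
    fidelity v (M + N) = fidelity v M + fidelity v N := by
  simp [fidelity, Matrix.add_mulVec]

theorem fidelity_sub {a : Type} [Fintype a] (v : a → ℂ) (M N : Matrix a a ℂ) :
    fidelity v (M - N) = fidelity v M - fidelity v N := by
  simp [fidelity, Matrix.sub_mulVec]

theorem fidelity_smul {a : Type} [Fintype a] (v : a → ℂ) (r : ℝ) (M : Matrix a a ℂ) :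
    fidelity v ((r : ℂ) • M) = r * fidelity v M := by
  simp [fidelity, Matrix.smul_mulVec]

theorem fidelity_sum {a ι : Type} [Fintype a] (v : a → ℂ) (s : Finset ι) (M : ι → Matrix a a ℂ) :
    fidelity v (∑ i ∈ s, M i) = ∑ i ∈ s, fidelity v (M i) := by
  simp [fidelity, Matrix.sum_mulVec, dotProduct_sum]

theorem fidelity_mul_mul_conjTranspose {a b : Type} [Fintype a] [Fintype b] (v : b → ℂ)
    (K : Matrix b a ℂ) (M : Matrix a a ℂ) : fidelity v (K * M * Kᴴ) = fidelity (Kᴴ *ᵥ v) M := by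
  simp only [fidelity]
  rw [star_mulVec_dotProduct, Matrix.conjTranspose_conjTranspose, Matrix.mulVec_mulVec,
    Matrix.mulVec_mulVec]

/-! ### Noisy circuits are channels -/

theorem extend_comp_embedding {k m : ℕ} (e : Fin k ↪ Fin m) (u : Fin k → ZMod 2)
    (x : Fin m → ZMod 2) : Function.extend e u x ∘ e = u :=
  funext fun i => e.injective.extend_apply _ _ i

theorem extend_extend_comp {k m : ℕ} (e : Fin k ↪ Fin m) (u v : Fin k → ZMod 2)
    (x : Fin m → ZMod 2) :
    Function.extend e v (Function.extend e u x) = Function.extend e v x := by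
  funext j
  by_cases h : ∃ i, e i = j
  · obtain ⟨i, rfl⟩ := h
    simp only [e.injective.extend_apply]
  · simp only [Function.extend_apply' _ _ _ h]

theorem extend_self_comp {k m : ℕ} (e : Fin k ↪ Fin m) (x : Fin m → ZMod 2) :
    Function.extend e (x ∘ e) x = x := by
  funext j
  by_cases h : ∃ i, e i = j
  · obtain ⟨i, rfl⟩ := h
    simp only [e.injective.extend_apply, Function.comp]
  · simp only [Function.extend_apply' _ _ _ h]

/-- Exchanging the qubits of a subregister with a second copy of the subregister. -/
theorem sum_extend_swap {k m : ℕ} (e : Fin k ↪ Fin m)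
    (f : (Fin m → ZMod 2) → (Fin k → ZMod 2) → ℂ) :
    ∑ x, ∑ u, f (Function.extend e u x) (x ∘ e) = ∑ x, ∑ u, f x u := by
  rw [← Fintype.sum_prod_type', ← Fintype.sum_prod_type']
  have hinv : Function.Involutive
      fun z : (Fin m → ZMod 2) × (Fin k → ZMod 2) => (Function.extend e z.2 z.1, z.1 ∘ e) := by
    rintro ⟨x, u⟩
    simp only [extend_comp_embedding, extend_extend_comp, extend_self_comp]
  exact Function.Bijective.sum_comp hinv.bijective fun z => f z.1 z.2

theorem isTP_actOn {k m : ℕ} (e : Fin k ↪ Fin m) {Φ : Op k →ₗ[ℂ] Op k} (hΦ : IsTP Φ) :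
    IsTP (actOn e Φ) := by
  intro M
  -- Multiplying by the number of subregister strings introduces a dummy string, which
  -- `sum_extend_swap` then exchanges with the actual contents of the subregister.
  have hc : (Fintype.card (Fin k → ZMod 2) : ℂ) ≠ 0 := by
    exact_mod_cast Fintype.card_ne_zero
  refine mul_left_cancel₀ hc ?_
  set F : (Fin m → ZMod 2) → Op k := fun x =>
    Matrix.of fun u v => M (Function.extend e u x) (Function.extend e v x)
  have hF : ∀ x u, F (Function.extend e u x) = F x := by
    intro x u
    ext i j
    simp only [F, Matrix.of_apply, extend_extend_comp]
  calc (Fintype.card (Fin k → ZMod 2) : ℂ) * (actOn e Φ M).trace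
      = ∑ x, ∑ _u : Fin k → ZMod 2, Φ (F x) (x ∘ e) (x ∘ e) := by
        simp only [Finset.sum_const, Finset.card_univ, nsmul_eq_mul, ← Finset.mul_sum]
        rfl
    _ = ∑ x, ∑ u, Φ (F x) u u := by
        rw [← sum_extend_swap e]
        simp only [extend_comp_embedding, hF]
    _ = ∑ x, (F x).trace := Finset.sum_congr rfl fun x _ => hΦ (F x)
    _ = ∑ x, ∑ u, M (Function.extend e u x) (Function.extend e u x) := rfl
    _ = ∑ x, ∑ _u : Fin k → ZMod 2, M x x := sum_extend_swap e fun x _ => M x x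
    _ = _ := by
        simp only [Finset.sum_const, Finset.card_univ, nsmul_eq_mul, ← Finset.mul_sum]
        rfl

/-- A Kraus operator on a subregister, as an operator on the whole register. -/
noncomputable def liftOp {k m : ℕ} (e : Fin k ↪ Fin m) (K : Op k) : Op m :=
  Matrix.of fun x z => ∑ u, if z = Function.extend e u x then K (x ∘ e) u else 0

theorem liftOp_mul_mul_apply {k m : ℕ} (e : Fin k ↪ Fin m) (K : Op k) (M : Op m)
    (x y : Fin m → ZMod 2) :
    (liftOp e K * M * (liftOp e K)ᴴ) x y
      = (K * (Matrix.of fun u v => M (Function.extend e u x) (Function.extend e v y)) * Kᴴ)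
        (x ∘ e) (y ∘ e) := by
  have h : ∀ z, (liftOp e K * M) x z = ∑ u, K (x ∘ e) u * M (Function.extend e u x) z := by
    intro z
    simp only [Matrix.mul_apply, liftOp, Matrix.of_apply, Finset.sum_mul]
    rw [Finset.sum_comm]
    simp [ite_mul]
  simp only [Matrix.mul_apply, h, Matrix.conjTranspose_apply, Matrix.of_apply]
  simp only [liftOp, Matrix.of_apply, star_sum, Finset.mul_sum]
  rw [Finset.sum_comm]
  refine Finset.sum_congr rfl fun v _ => ?_
  rw [Finset.sum_eq_single (Function.extend e v y)]
  · simp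
  · intro z _ hz
    simp [hz]
  · simp

theorem isCP_actOn {k m : ℕ} (e : Fin k ↪ Fin m) {Φ : Op k →ₗ[ℂ] Op k} (hΦ : IsCP Φ) :
    IsCP (actOn e Φ) := by
  obtain ⟨ι, _, K, hK⟩ := hΦ
  refine ⟨ι, inferInstance, fun i => liftOp e (K i), fun M => ?_⟩
  ext x y
  simp only [Matrix.sum_apply, liftOp_mul_mul_apply]
  exact (congrFun (congrFun (hK _) _) _).trans (by simp only [Matrix.sum_apply])

theorem actOn_add {k m : ℕ} (e : Fin k ↪ Fin m) (Φ Ψ : Op k →ₗ[ℂ] Op k) :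
    actOn e (Φ + Ψ) = actOn e Φ + actOn e Ψ := rfl

theorem actOn_smul {k m : ℕ} (e : Fin k ↪ Fin m) (c : ℂ) (Φ : Op k →ₗ[ℂ] Op k) :
    actOn e (c • Φ) = c • actOn e Φ := rfl

theorem isCP_insertQubit {m : ℕ} (i : Fin (m + 1)) {σ : Matrix (ZMod 2) (ZMod 2) ℂ}
    (hσ : σ.PosSemidef) : IsCP (insertQubit i σ) := by
  obtain ⟨B, rfl⟩ := hσ.exists_eq_conjTranspose_mul_self
  refine ⟨ZMod 2, inferInstance, fun r => Matrix.of fun x z =>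
    if i.removeNth x = z then star (B r (x i)) else 0, fun M => ?_⟩
  ext x y
  simp only [insertQubit, LinearMap.coe_mk, AddHom.coe_mk, Matrix.of_apply, Matrix.sum_apply,
    Matrix.mul_apply, Matrix.conjTranspose_apply, Finset.sum_mul]
  refine Finset.sum_congr rfl fun r _ => ?_
  simp [ite_mul, apply_ite (starRingEnd ℂ)]
  ring

theorem isTP_insertQubit {m : ℕ} (i : Fin (m + 1)) {σ : Matrix (ZMod 2) (ZMod 2) ℂ}
    (hσ : σ.trace = 1) : IsTP (insertQubit i σ) := by
  intro M
  have h : (insertQubit i σ M).trace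
      = ∑ x : Fin (m + 1) → ZMod 2, σ (x i) (x i) * M (i.removeNth x) (i.removeNth x) := rfl
  rw [h, ← (Fin.insertNthEquiv (fun _ => ZMod 2) i).sum_comp, Fintype.sum_prod_type]
  have hi : ∀ (a : ZMod 2) (x : Fin m → ZMod 2),
      i.removeNth (Fin.insertNthEquiv (fun _ => ZMod 2) i (a, x)) = x :=
    fun a x => Fin.removeNth_insertNth (α := fun _ => ZMod 2) i a x
  simp only [Fin.insertNthEquiv_apply, Fin.insertNth_apply_same, hi]
  rw [← one_mul M.trace, ← hσ, Matrix.trace, Matrix.trace, Finset.sum_mul_sum]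
  rfl

/-- Measuring qubit `i` with the functional `β`. -/
noncomputable def measureOp {m : ℕ} (i : Fin (m + 1)) (β : ZMod 2 → ℂ) :
    Matrix (Fin m → ZMod 2) (Fin (m + 1) → ZMod 2) ℂ :=
  Matrix.of fun x z => ∑ a, if z = Fin.insertNth (α := fun _ => ZMod 2) i a x then β a else 0

theorem measureOp_mul_mul_apply {m : ℕ} (i : Fin (m + 1)) (β : ZMod 2 → ℂ) (M : Op (m + 1))
    (x y : Fin m → ZMod 2) :
    (measureOp i β * M * (measureOp i β)ᴴ) x y = ∑ a, ∑ b, star (β b) * β a *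
      M (Fin.insertNth (α := fun _ => ZMod 2) i a x)
        (Fin.insertNth (α := fun _ => ZMod 2) i b y) := by
  have h : ∀ z, (measureOp i β * M) x z
      = ∑ a, β a * M (Fin.insertNth (α := fun _ => ZMod 2) i a x) z := by
    intro z
    simp only [Matrix.mul_apply, measureOp, Matrix.of_apply, Finset.sum_mul]
    rw [Finset.sum_comm]
    simp [ite_mul]
  rw [Matrix.mul_apply]
  simp only [h, Matrix.conjTranspose_apply]
  simp only [measureOp, Matrix.of_apply, star_sum, Finset.mul_sum]
  rw [Finset.sum_comm]
  refine Eq.trans ?_ Finset.sum_comm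
  refine Finset.sum_congr rfl fun b _ => ?_
  rw [Finset.sum_eq_single (Fin.insertNth (α := fun _ => ZMod 2) i b y)]
  · simp only [if_true, Finset.sum_mul]
    refine Finset.sum_congr rfl fun a _ => ?_
    ring
  · intro w _ hw
    simp [hw]
  · simp

theorem isCP_removeQubit {m : ℕ} (i : Fin (m + 1)) {A : Matrix (ZMod 2) (ZMod 2) ℂ}
    (hA : A.PosSemidef) : IsCP (removeQubit i A) := by
  obtain ⟨B, rfl⟩ := hA.exists_eq_conjTranspose_mul_self
  refine ⟨ZMod 2, inferInstance, fun r => measureOp i (B r), fun M => ?_⟩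
  ext x y
  simp only [Matrix.sum_apply, measureOp_mul_mul_apply]
  simp only [removeQubit, LinearMap.coe_mk, AddHom.coe_mk, Matrix.of_apply,
    Matrix.mul_apply, Matrix.conjTranspose_apply, Finset.sum_mul]
  refine Eq.trans ?_ Finset.sum_comm
  refine Finset.sum_congr rfl fun a _ => ?_
  rw [Finset.sum_comm]

/-- Single outcomes need not preserve the trace; effects summing to the identity turn the total into
a partial trace. -/
theorem trace_removeQubit {m : ℕ} (i : Fin (m + 1)) (A : ZMod 2 → Matrix (ZMod 2) (ZMod 2) ℂ)
    (hA : ∑ o, A o = 1) (M : Op (m + 1)) : ∑ o, (removeQubit i (A o) M).trace = M.trace := by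
  have h : ∀ o, (removeQubit i (A o) M).trace
      = ∑ x : Fin m → ZMod 2, ∑ a, ∑ b, A o b a * M (i.insertNth a x) (i.insertNth b x) :=
    fun _ => rfl
  have hA' : ∀ a b, ∑ o, A o b a = if b = a then 1 else 0 := by
    intro a b
    rw [← Matrix.one_apply, ← hA, Matrix.sum_apply]
  have hM : M.trace = ∑ x : Fin (m + 1) → ZMod 2, M x x := rfl
  rw [hM, ← (Fin.insertNthEquiv (fun _ => ZMod 2) i).sum_comp, Fintype.sum_prod_type]
  have hi : ∀ (a : ZMod 2) (x : Fin m → ZMod 2), Fin.insertNthEquiv (fun _ => ZMod 2) i (a, x)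
      = Fin.insertNth (α := fun _ => ZMod 2) i a x := fun _ _ => rfl
  simp only [h, hi]
  rw [Finset.sum_comm]
  refine Eq.trans ?_ Finset.sum_comm
  refine Finset.sum_congr rfl fun x _ => ?_
  rw [Finset.sum_comm]
  refine Finset.sum_congr rfl fun a _ => ?_
  rw [Finset.sum_comm]
  simp only [← Finset.sum_mul, hA']
  simp

namespace Realization

/-- Every component is a completely positive trace-preserving map. -/
def IsCPTP (R : Realization) : Prop :=
  (∀ tag m k (e : Fin k ↪ Fin m) U, IsCP (R.gate tag m k e U) ∧ IsTP (R.gate tag m k e U)) ∧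
  (∀ tag m i, (R.prepare tag m i).PosSemidef ∧ (R.prepare tag m i).trace = 1) ∧
  (∀ tag m i, (∀ o, (R.measure tag m i o).PosSemidef) ∧ ∑ o, R.measure tag m i o = 1)

theorem isCP_ideal_gate (tag m k : ℕ) (e : Fin k ↪ Fin m)
    (U : Matrix.unitaryGroup (Fin k → ZMod 2) ℂ) : IsCP (ideal.gate tag m k e U) :=
  isCP_sandwich _

theorem isTP_ideal_gate (tag m k : ℕ) (e : Fin k ↪ Fin m)
    (U : Matrix.unitaryGroup (Fin k → ZMod 2) ℂ) : IsTP (ideal.gate tag m k e U) :=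
  isTP_sandwich (Matrix.mem_unitaryGroup_iff'.1 U.2)

theorem posSemidef_single (o : ZMod 2) :
    (Matrix.single o o (1 : ℂ)).PosSemidef := by
  have : Matrix.single o o (1 : ℂ) = Matrix.vecMulVec (Pi.single o 1) (star (Pi.single o 1)) := by
    rw [← Pi.single_star, star_one, ← Matrix.single_eq_single_vecMulVec_single]
  rw [this]
  exact Matrix.posSemidef_vecMulVec_self_star _

theorem posSemidef_convex {a : Type} [Fintype a] {p : ℝ} (hp0 : 0 ≤ p) (hp1 : p ≤ 1)
    {A B : Matrix a a ℂ} (hA : A.PosSemidef) (hB : B.PosSemidef) :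
    (((1 - p : ℝ) : ℂ) • A + (p : ℂ) • B).PosSemidef :=
  (hA.smul (by exact_mod_cast sub_nonneg.2 hp1)).add (hB.smul (by exact_mod_cast hp0))

theorem IsStochasticNoise.isCPTP {p : ℝ} (hp0 : 0 ≤ p) (hp1 : p ≤ 1) {R : Realization}
    (hR : R.IsStochasticNoise p) : R.IsCPTP := by
  obtain ⟨N, ⟨hNg, hNp, hNm⟩, hg, hp, hm⟩ := hR
  refine ⟨fun tag m k e U => ⟨?_, ?_⟩, fun tag m i => ⟨?_, ?_⟩, fun tag m i => ⟨fun o => ?_, ?_⟩⟩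
  · rw [hg]
    exact ((isCP_ideal_gate _ _ _ _ _).smul (sub_nonneg.2 hp1)).add ((hNg _ _ _ _ _).isCP.smul hp0)
  · intro M
    rw [hg, LinearMap.add_apply, LinearMap.smul_apply, LinearMap.smul_apply, Matrix.trace_add,
      Matrix.trace_smul, Matrix.trace_smul, isTP_ideal_gate, (hNg _ _ _ _ _).2, smul_eq_mul,
      smul_eq_mul]
    push_cast
    ring
  · rw [hp]
    exact posSemidef_convex hp0 hp1 (posSemidef_single 0) (hNp _ _ _).1
  · rw [hp, Matrix.trace_add, Matrix.trace_smul, Matrix.trace_smul, (hNp _ _ _).2]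
    simp [ideal]
  · rw [hm]
    exact posSemidef_convex hp0 hp1 (posSemidef_single o) ((hNm _ _ _).1 o)
  · simp only [hm]
    rw [Finset.sum_add_distrib, ← Finset.smul_sum, ← Finset.smul_sum, (hNm _ _ _).2]
    have : ∑ o, ideal.measure tag m i o = 1 := by
      ext a b
      simp [ideal, Matrix.sum_apply, Matrix.single_apply, Matrix.one_apply, ite_and]
    rw [this, ← add_smul]
    simp

end Realization

namespace Circuit

theorem isCP_run {R : Realization} (hR : R.IsCPTP) {out m : ℕ} (c : Circuit out m) :
    IsCP (c.run R) := by
  induction c with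
  | done => exact IsCP.id
  | gate tag hk e U next ih => exact ih.comp (isCP_actOn e (hR.1 _ _ _ _ _).1)
  | prepare tag i next ih => exact ih.comp (isCP_insertQubit i (hR.2.1 _ _ _).1)
  | measure tag i next ih =>
    exact IsCP.sum _ fun o _ => (ih o).comp (isCP_removeQubit i ((hR.2.2 _ _ _).1 o))
  | random α w hw hw1 next ih => exact IsCP.sum _ fun a _ => (ih a).smul (hw a)

theorem isTP_run {R : Realization} (hR : R.IsCPTP) {out m : ℕ} (c : Circuit out m) :
    IsTP (c.run R) := by
  induction c with
  | done => exact fun M => rfl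
  | gate tag hk e U next ih => exact ih.comp (isTP_actOn e (hR.1 _ _ _ _ _).2)
  | prepare tag i next ih => exact ih.comp (isTP_insertQubit i (hR.2.1 _ _ _).2)
  | measure tag i next ih =>
    intro M
    rw [← trace_removeQubit i _ (hR.2.2 tag _ i).2 M]
    simp only [run, LinearMap.sum_apply, Matrix.trace_sum]
    exact Finset.sum_congr rfl fun o _ => ih o _
  | random α w hw hw1 next ih =>
    intro M
    have : ∀ a, (run R (next a) M).trace = M.trace := fun a => ih a M
    simp only [run, LinearMap.sum_apply, Matrix.trace_sum, LinearMap.smul_apply,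
      Matrix.trace_smul, this, smul_eq_mul]
    rw [← Finset.sum_mul, ← Complex.ofReal_sum, hw1, Complex.ofReal_one, one_mul]

theorem run_after (R : Realization) {mid out m : ℕ} (d : Circuit out mid) (c : Circuit mid m) :
    (d.after c).run R = d.run R ∘ₗ c.run R := by
  induction c with
  | done => rfl
  | gate tag hk e U next ih => simp only [after, run, ih, LinearMap.comp_assoc]
  | prepare tag i next ih => simp only [after, run, ih, LinearMap.comp_assoc]
  | measure tag i next ih =>
    simp only [after, run, ih, LinearMap.comp_assoc]
    exact LinearMap.ext fun M => by simp
  | random α w hw hw1 next ih =>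
    simp only [after, run, ih]
    exact LinearMap.ext fun M => by simp

end Circuit

/-! ### Characters and Pauli operators -/

/-- The character `(-1)^{a·x}`. -/
noncomputable def bitChar {n : ℕ} (a x : Fin n → ZMod 2) : ℂ := (-1) ^ (a ⬝ᵥ x).val

theorem neg_one_pow_val_add (s t : ZMod 2) :
    (-1 : ℂ) ^ (s + t).val = (-1) ^ s.val * (-1) ^ t.val := by
  rw [ZMod.val_add, ← pow_add, neg_one_pow_eq_pow_mod_two (s.val + t.val)]

theorem bitChar_add_right {n : ℕ} (a x y : Fin n → ZMod 2) :
    bitChar a (x + y) = bitChar a x * bitChar a y := by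
  rw [bitChar, dotProduct_add, neg_one_pow_val_add]; rfl

theorem bitChar_add_left {n : ℕ} (a b x : Fin n → ZMod 2) :
    bitChar (a + b) x = bitChar a x * bitChar b x := by
  rw [bitChar, add_dotProduct, neg_one_pow_val_add]; rfl

theorem star_bitChar {n : ℕ} (a x : Fin n → ZMod 2) : star (bitChar a x) = bitChar a x := by
  simp [bitChar]

theorem norm_bitChar {n : ℕ} (a x : Fin n → ZMod 2) : ‖bitChar a x‖ = 1 := by
  simp [bitChar]

theorem add_self_bits {n : ℕ} (x : Fin n → ZMod 2) : x + x = 0 :=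
  funext fun i => CharTwo.add_self_eq_zero (x i)

theorem add_eq_zero_iff_bits {n : ℕ} (x y : Fin n → ZMod 2) : x + y = 0 ↔ x = y := by
  constructor
  · intro h
    rw [← add_zero x, ← add_self_bits y, ← add_assoc, h, zero_add]
  · rintro rfl
    exact add_self_bits x

/-- If `t j ≠ 0`, shifting `a` by the `j`-th unit vector flips every sign, so the sum equals its own
negative. -/
theorem sum_bitChar {n : ℕ} (t : Fin n → ZMod 2) :
    ∑ a, bitChar a t = if t = 0 then (2 : ℂ) ^ n else 0 := by
  split_ifs with h
  · subst h
    simp [bitChar]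
  · obtain ⟨j, hj⟩ := Function.ne_iff.1 h
    have hj1 : t j = 1 := by
      have : ∀ z : ZMod 2, z ≠ 0 → z = 1 := by decide
      exact this _ hj
    have hs : ∑ a, bitChar a t = ∑ a, bitChar (a + Pi.single j 1) t :=
      (Equiv.sum_comp (Equiv.addRight (Pi.single j 1)) fun a : Fin n → ZMod 2 => bitChar a t).symm
    have hm : bitChar (Pi.single j 1) t = -1 := by
      simp [bitChar, hj1, ZMod.val_one]
    simp only [bitChar_add_left, hm, ← Finset.sum_mul] at hs
    linear_combination hs / 2

/-- Parseval's identity on bit strings. -/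
theorem sum_norm_sum_bitChar_mul_sq {n : ℕ} (τ : (Fin n → ZMod 2) → ℂ) :
    ∑ a, ‖∑ t, bitChar a t * τ t‖ ^ 2 = 2 ^ n * ∑ t, ‖τ t‖ ^ 2 := by
  have h : ((∑ a, ‖∑ t, bitChar a t * τ t‖ ^ 2 : ℝ) : ℂ)
      = ((2 ^ n * ∑ t, ‖τ t‖ ^ 2 : ℝ) : ℂ) := by
    push_cast
    simp only [← Complex.mul_conj', map_sum, map_mul, Finset.sum_mul_sum]
    have : ∀ a x y, bitChar a x * τ x * ((starRingEnd ℂ) (bitChar a y) * (starRingEnd ℂ) (τ y))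
        = bitChar a (x + y) * (τ x * (starRingEnd ℂ) (τ y)) := by
      intro a x y
      rw [bitChar_add_right, ← star_bitChar a y]
      simp only [RCLike.star_def, Complex.conj_conj]
      rw [← RCLike.star_def, star_bitChar]
      ring
    simp only [this]
    rw [Finset.sum_comm, Finset.mul_sum]
    refine Finset.sum_congr rfl fun x _ => ?_
    rw [Finset.sum_comm]
    simp only [← Finset.sum_mul, sum_bitChar, add_eq_zero_iff_bits]
    simp
  exact_mod_cast h

theorem pauli_apply {n : ℕ} (P : PauliLabel n) (y x : Fin n → ZMod 2) :
    pauli P y x = if y = x + P.2 then Complex.I ^ (P.1 ⬝ᵥ P.2).val * bitChar P.1 x else 0 := rfl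

theorem conj_I_pow_val (s : ZMod 2) :
    (starRingEnd ℂ) (Complex.I ^ s.val) = Complex.I ^ s.val * (-1) ^ s.val := by
  have : ∀ s : ZMod 2, s = 0 ∨ s = 1 := by decide
  rcases this s with rfl | rfl <;> simp [ZMod.val_one]

theorem I_pow_mul_conj {k : ℕ} : Complex.I ^ k * (starRingEnd ℂ) (Complex.I ^ k) = 1 := by
  rw [Complex.mul_conj']
  simp

theorem pauli_conjTranspose {n : ℕ} (P : PauliLabel n) : (pauli P)ᴴ = pauli P := by
  ext y x
  rw [Matrix.conjTranspose_apply, pauli_apply, pauli_apply]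
  have hiff : x = y + P.2 ↔ y = x + P.2 := by
    rw [← add_eq_zero_iff_bits, ← add_eq_zero_iff_bits y]
    constructor <;> intro h <;> rw [← h] <;> abel
  by_cases h : y = x + P.2
  · rw [if_pos (hiff.2 h), if_pos h, star_mul', star_bitChar, RCLike.star_def, conj_I_pow_val, h,
      bitChar_add_right]
    have : bitChar P.1 P.2 = (-1) ^ (P.1 ⬝ᵥ P.2).val := rfl
    rw [this, mul_assoc, mul_left_comm ((-1 : ℂ) ^ _), ← pow_add, Even.neg_one_pow ⟨_, rfl⟩, mul_one]
  · rw [if_neg (fun e => h (hiff.1 e)), if_neg h, star_zero]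

theorem pauli_mul_self {n : ℕ} (P : PauliLabel n) : pauli P * pauli P = 1 := by
  have h := Matrix.mem_unitaryGroup_iff.1 (pauli_mem_unitary P)
  rwa [Matrix.star_eq_conjTranspose, pauli_conjTranspose] at h

/-- The phase `i^{a·b}` cancels, so conjugation shifts both indices and multiplies by a character.
The later identities for Pauli conjugation reduce to this form. -/
theorem pauli_conj_apply {n : ℕ} (P : PauliLabel n) (L : Op n) (y y' : Fin n → ZMod 2) :
    (pauli P * L * (pauli P)ᴴ) y y'
      = bitChar P.1 (y + y') * L (y + P.2) (y' + P.2) := by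
  have hiff : ∀ x y : Fin n → ZMod 2, y = x + P.2 ↔ x = y + P.2 := by
    intro x y
    rw [← add_eq_zero_iff_bits, ← add_eq_zero_iff_bits x]
    constructor <;> intro h <;> rw [← h] <;> abel
  have h1 : ∀ x, (pauli P * L) y x
      = Complex.I ^ (P.1 ⬝ᵥ P.2).val * bitChar P.1 (y + P.2) * L (y + P.2) x := by
    intro x
    rw [Matrix.mul_apply]
    simp only [pauli_apply, hiff _ y]
    simp
  rw [Matrix.mul_apply]
  simp only [h1, Matrix.conjTranspose_apply, pauli_apply, hiff _ y']
  simp only [apply_ite star, star_zero, mul_ite, mul_zero, Finset.sum_ite_eq', Finset.mem_univ,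
    if_true]
  rw [star_mul', star_bitChar, RCLike.star_def]
  have e : bitChar P.1 (y + y') = bitChar P.1 (y + P.2) * bitChar P.1 (y' + P.2) := by
    rw [← bitChar_add_right]
    congr 1
    rw [add_add_add_comm, add_self_bits, add_zero]
  rw [e]
  linear_combination (bitChar P.1 (y + P.2) * bitChar P.1 (y' + P.2) * L (y + P.2) (y' + P.2)) *
    I_pow_mul_conj (k := (P.1 ⬝ᵥ P.2).val)

/-- The Pauli operators form a unitary 1-design. -/
theorem sum_pauli_conj {n : ℕ} (L : Op n) :
    ∑ P : PauliLabel n, pauli P * L * (pauli P)ᴴ = ((2 : ℂ) ^ n * L.trace) • (1 : Op n) := by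
  ext y y'
  simp only [Matrix.sum_apply, pauli_conj_apply]
  rw [Fintype.sum_prod_type, Finset.sum_comm]
  simp only [← Finset.sum_mul, sum_bitChar, add_eq_zero_iff_bits]
  rw [← Finset.mul_sum]
  by_cases h : y = y'
  · subst h
    rw [if_pos rfl]
    have : ∑ b, L (y + b) (y + b) = L.trace := Equiv.sum_comp (Equiv.addLeft y) fun x => L x x
    simp [this]
  · simp [h]

/-- Without phases, conjugations add in their labels. A layer of single-qubit gates can therefore be
computed by summing labels, in any order. -/
theorem sandwich_pauli_comp {n : ℕ} (P Q : PauliLabel n) :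
    sandwich (pauli P) ∘ₗ sandwich (pauli Q) = sandwich (pauli (P + Q)) := by
  refine LinearMap.ext fun M => ?_
  ext y y'
  change (pauli P * (pauli Q * M * (pauli Q)ᴴ) * (pauli P)ᴴ) y y'
    = (pauli (P + Q) * M * (pauli (P + Q))ᴴ) y y'
  rw [pauli_conj_apply, pauli_conj_apply, pauli_conj_apply, Prod.fst_add, Prod.snd_add,
    bitChar_add_left, add_add_add_comm, add_self_bits, add_zero, add_assoc, add_assoc, mul_assoc]

theorem sandwich_pauli_zero {n : ℕ} :
    sandwich (pauli (0 : PauliLabel n)) = LinearMap.id := by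
  refine LinearMap.ext fun M => ?_
  ext y y'
  change (pauli (0 : PauliLabel n) * M * (pauli (0 : PauliLabel n))ᴴ) y y' = M y y'
  rw [pauli_conj_apply]
  simp [bitChar]

/-- The Pauli operator at qubit `j` only. -/
def PauliLabel.atQubit {n : ℕ} (P : PauliLabel n) (j : Fin n) : PauliLabel n :=
  (Pi.single j (P.1 j), Pi.single j (P.2 j))

theorem PauliLabel.sum_atQubit {n : ℕ} (P : PauliLabel n) : ∑ j, P.atQubit j = P := by
  refine Prod.ext ?_ ?_
  · rw [Prod.fst_sum]
    exact Finset.univ_sum_single P.1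
  · rw [Prod.snd_sum]
    exact Finset.univ_sum_single P.2

theorem actOn_sandwich_pauli {n : ℕ} (P : PauliLabel n) (j : Fin n)
    (h : Function.Injective fun _ : Fin 1 => j) :
    actOn ⟨fun _ : Fin 1 => j, h⟩
      (sandwich (pauli ((fun _ => P.1 j, fun _ => P.2 j) : PauliLabel 1)))
      = sandwich (pauli (P.atQubit j)) := by
  refine LinearMap.ext fun M => ?_
  ext x y
  set e : Fin 1 ↪ Fin n := ⟨fun _ : Fin 1 => j, h⟩
  set p : PauliLabel 1 := (fun _ => P.1 j, fun _ => P.2 j)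
  change (pauli p * (Matrix.of fun u v => M (Function.extend e u x) (Function.extend e v y)) *
    (pauli p)ᴴ) (x ∘ e) (y ∘ e) = (pauli (P.atQubit j) * M * (pauli (P.atQubit j))ᴴ) x y
  rw [pauli_conj_apply, pauli_conj_apply]
  have h1 : ∀ x : Fin n → ZMod 2,
      Function.extend e (x ∘ e + p.2) x = x + (P.atQubit j).2 := by
    intro x
    funext i
    by_cases hi : i = j
    · subst hi
      have := e.injective.extend_apply (x ∘ e + p.2) x 0
      exact this.trans (by simp [p, e, PauliLabel.atQubit])
    · rw [Function.extend_apply' _ _ _ (by rintro ⟨_, rfl⟩; exact hi rfl)]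
      simp [PauliLabel.atQubit, hi]
  rw [Matrix.of_apply, h1, h1]
  congr 1
  simp [bitChar, p, e, PauliLabel.atQubit, dotProduct, Pi.single_apply]

/-! ### The noisy Pauli layer -/

theorem run_pauliLayer_ideal {out n : ℕ} (tag : Fin n → ℕ) (P : PauliLabel n)
    (rest : Circuit out n) : (pauliLayer tag P rest).run Realization.ideal
      = rest.run Realization.ideal ∘ₗ sandwich (pauli P) := by
  have key : ∀ l : List (Fin n), (l.foldr
      (fun j c => Circuit.gate (k := 1) (tag j) (Or.inl rfl)
        ⟨fun _ => j, fun _ _ _ => Subsingleton.elim _ _⟩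
        ⟨pauli (fun _ => P.1 j, fun _ => P.2 j), pauli_mem_unitary _⟩ c) rest).run Realization.ideal
      = rest.run Realization.ideal ∘ₗ sandwich (pauli (l.map P.atQubit).sum) := by
    intro l
    induction l with
    | nil => simp [sandwich_pauli_zero]
    | cons j l ih =>
      rw [List.foldr_cons, Circuit.run, ih, List.map_cons, List.sum_cons, add_comm,
        ← sandwich_pauli_comp, LinearMap.comp_assoc]
      congr 1
      exact congrArg _ (actOn_sandwich_pauli P j _)
  rw [pauliLayer, key, ← List.ofFn_eq_map, List.sum_ofFn, P.sum_atQubit]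

/-- Each noisy gate is `(1-p)` times the ideal one plus a completely positive remainder. `Θ`
collects all branches with at least one fault in the layer. -/
theorem exists_run_pauliLayer_eq {p : ℝ} (hp0 : 0 ≤ p) (hp1 : p ≤ 1) {R : Realization}
    (hR : R.IsStochasticNoise p) {out n : ℕ} (tag : Fin n → ℕ) (P : PauliLabel n)
    (rest : Circuit out n) : ∃ Θ : Op n →ₗ[ℂ] Op out, IsCP Θ ∧ (pauliLayer tag P rest).run R
      = (((1 - p) ^ n : ℝ) : ℂ) • (rest.run R ∘ₗ sandwich (pauli P)) + Θ := by
  have hC := hR.isCPTP hp0 hp1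
  obtain ⟨N, hN, hg, -, -⟩ := hR
  have key : ∀ l : List (Fin n), ∃ Θ : Op n →ₗ[ℂ] Op out, IsCP Θ ∧ (l.foldr
      (fun j c => Circuit.gate (k := 1) (tag j) (Or.inl rfl)
        ⟨fun _ => j, fun _ _ _ => Subsingleton.elim _ _⟩
        ⟨pauli (fun _ => P.1 j, fun _ => P.2 j), pauli_mem_unitary _⟩ c) rest).run R
      = (((1 - p) ^ l.length : ℝ) : ℂ) •
        (rest.run R ∘ₗ sandwich (pauli (l.map P.atQubit).sum)) + Θ := by
    intro l
    induction l with
    | nil => exact ⟨0, IsCP.zero, by simp [sandwich_pauli_zero]⟩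
    | cons j l ih =>
      obtain ⟨Θ, hΘ, h⟩ := ih
      set e : Fin 1 ↪ Fin n := ⟨fun _ => j, fun _ _ _ => Subsingleton.elim _ _⟩
      set U : Matrix.unitaryGroup (Fin 1 → ZMod 2) ℂ :=
        ⟨pauli (fun _ => P.1 j, fun _ => P.2 j), pauli_mem_unitary _⟩
      have hact : actOn e (R.gate (tag j) n 1 e U)
          = ((1 - p : ℝ) : ℂ) • sandwich (pauli (P.atQubit j))
            + (p : ℂ) • actOn e (N.gate (tag j) n 1 e U) := by
        rw [hg, actOn_add, actOn_smul, actOn_smul]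
        congr 2
        exact actOn_sandwich_pauli P j _
      -- First summand: a fault at gate `j` and none in the rest of the layer. Second: some fault in
      -- the rest of the layer, with gate `j` fully noisy.
      refine ⟨(((1 - p) ^ l.length : ℝ) : ℂ) •
          ((rest.run R ∘ₗ sandwich (pauli (l.map P.atQubit).sum)) ∘ₗ
            ((p : ℂ) • actOn e (N.gate (tag j) n 1 e U)))
          + Θ ∘ₗ actOn e (R.gate (tag j) n 1 e U), ?_, ?_⟩
      · refine IsCP.add (IsCP.smul ?_ (pow_nonneg (sub_nonneg.2 hp1) _))
          (hΘ.comp (isCP_actOn e (hC.1 _ _ _ _ _).1))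
        exact ((Circuit.isCP_run hC rest).comp (isCP_sandwich _)).comp
          ((isCP_actOn e (hN.1 _ _ _ _ _).isCP).smul hp0)
      · rw [List.foldr_cons, Circuit.run, h, List.map_cons, List.sum_cons,
          add_comm (P.atQubit j), ← sandwich_pauli_comp, List.length_cons, LinearMap.add_comp,
          ← add_assoc]
        congr 1
        rw [hact]
        refine LinearMap.ext fun M => ?_
        simp only [LinearMap.add_apply, LinearMap.smul_apply, LinearMap.comp_apply, map_add, map_smul]
        push_cast
        module
  obtain ⟨Θ, hΘ, h⟩ := key (List.finRange n)
  refine ⟨Θ, hΘ, ?_⟩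
  rw [← List.ofFn_eq_map, List.sum_ofFn, P.sum_atQubit, List.length_finRange] at h
  exact h

/-! ### Twirling and entanglement fidelity -/

theorem norm_sum_sq_le_card_mul {ι : Type} [Fintype ι] (f : ι → ℂ) :
    ‖∑ i, f i‖ ^ 2 ≤ Fintype.card ι * ∑ i, ‖f i‖ ^ 2 :=
  (pow_le_pow_left₀ (norm_nonneg _) (norm_sum_le _ _) 2).trans sq_sum_le_card_mul_sum_sq

theorem normSq_sum_le {ι a : Type} [Fintype ι] [Fintype a] (w : ι → a → ℂ) :
    normSq (∑ i, w i) ≤ Fintype.card ι * ∑ i, normSq (w i) := by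
  simp only [normSq]
  rw [Finset.sum_comm, Finset.mul_sum]
  refine Finset.sum_le_sum fun j _ => ?_
  rw [Finset.sum_apply]
  exact norm_sum_sq_le_card_mul _

theorem fidelity_conjTranspose_mul_self {a b : Type} [Fintype a] [Fintype b] (v : a → ℂ)
    (B : Matrix b a ℂ) : fidelity v (Bᴴ * B) = normSq (B *ᵥ v) := by
  rw [fidelity, ← normSq_mulVec, Complex.ofReal_re]

theorem fidelity_vecMulVec {a b : Type} [Fintype a] [Fintype b] (v : b → ℂ) (u : a → ℂ)
    (K : Matrix b a ℂ) :
    fidelity v (K * Matrix.vecMulVec u (star u) * Kᴴ) = ‖star v ⬝ᵥ (K *ᵥ u)‖ ^ 2 := by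
  have h : K * Matrix.vecMulVec u (star u) * Kᴴ
      = Matrix.vecMulVec (K *ᵥ u) (star (K *ᵥ u)) := by
    rw [Matrix.mul_vecMulVec, Matrix.vecMulVec_mul, Matrix.star_mulVec]
  rw [h, fidelity, Matrix.vecMulVec_mulVec]
  have h2 : star (K *ᵥ u) ⬝ᵥ v = star (star v ⬝ᵥ (K *ᵥ u)) := by
    rw [Matrix.star_dotProduct]
  rw [h2, dotProduct_smul]
  simp only [MulOpposite.smul_eq_mul_unop, MulOpposite.unop_op, RCLike.star_def, Complex.mul_conj']
  exact_mod_cast rfl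

/-- Averaging over the Pauli group keeps the identity component of a Kraus operator. -/
theorem norm_trace_sq_mul_fidelity_le {n : ℕ} (v : (Fin n → ZMod 2) → ℂ) (L : Op n) {ψ : Op n}
    (hψ : ψ.PosSemidef) :
    ‖L.trace‖ ^ 2 * fidelity v ψ ≤ ∑ P : PauliLabel n,
      fidelity v (pauli P * (L * (pauli P * ψ * (pauli P)ᴴ) * Lᴴ) * (pauli P)ᴴ) := by
  obtain ⟨B, rfl⟩ := hψ.exists_eq_conjTranspose_mul_self
  have hterm : ∀ P : PauliLabel n,
      fidelity v (pauli P * (L * (pauli P * (Bᴴ * B) * (pauli P)ᴴ) * Lᴴ) * (pauli P)ᴴ)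
        = normSq ((B * (pauli P * L * (pauli P)ᴴ)ᴴ) *ᵥ v) := by
    intro P
    rw [← fidelity_conjTranspose_mul_self]
    congr 1
    simp only [Matrix.conjTranspose_mul, Matrix.conjTranspose_conjTranspose, pauli_conjTranspose,
      Matrix.mul_assoc]
  simp only [hterm]
  -- Cauchy–Schwarz over the `4^n` labels; this factor cancels the square of the `2^n` in
  -- `sum_pauli_conj`.
  have h := normSq_sum_le fun P : PauliLabel n => (B * (pauli P * L * (pauli P)ᴴ)ᴴ) *ᵥ v
  rw [← Matrix.sum_mulVec, ← Matrix.mul_sum, ← Matrix.conjTranspose_sum, sum_pauli_conj] at h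
  have hl : normSq ((B * ((((2 : ℂ) ^ n * L.trace) • (1 : Op n)))ᴴ) *ᵥ v)
      = ((2 : ℝ) ^ n) ^ 2 * (‖L.trace‖ ^ 2 * fidelity v (Bᴴ * B)) := by
    rw [fidelity_conjTranspose_mul_self, Matrix.conjTranspose_smul, Matrix.conjTranspose_one,
      Matrix.mul_smul, Matrix.mul_one, Matrix.smul_mulVec]
    simp only [normSq, Pi.smul_apply, norm_smul, mul_pow, ← Finset.mul_sum]
    simp [mul_pow]
    ring
  have hc : (Fintype.card (PauliLabel n) : ℝ) = ((2 : ℝ) ^ n) ^ 2 := by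
    simp [Fintype.card_prod, sq]
  rw [hl, hc] at h
  exact le_of_mul_le_mul_left h (by positivity)

/-- The entanglement fidelity of a channel that nearly preserves all pure states. -/
theorem sum_norm_trace_sq_ge {n : ℕ} {ι : Type} [Fintype ι] (L : ι → Op n)
    (hL : ∑ i, (L i)ᴴ * L i = 1) {ε : ℝ}
    (hε : ∀ v : (Fin n → ZMod 2) → ℂ, normSq v = 1 →
      1 - ε ≤ ∑ i, ‖star v ⬝ᵥ (L i *ᵥ v)‖ ^ 2) :
    ((2 : ℝ) ^ n) ^ 2 * (1 - 2 * ε) ≤ ∑ i, ‖(L i).trace‖ ^ 2 := by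
  set d : ℝ := (2 : ℝ) ^ n with hd
  have hd0 : 0 < d := by positivity
  have hcard : (Fintype.card (Fin n → ZMod 2) : ℝ) = d := by simp [hd]
  have hconst : ∀ r : ℝ, ∑ _x : Fin n → ZMod 2, r = d * r := fun r => by
    rw [Finset.sum_const, Finset.card_univ, nsmul_eq_mul, hcard]
  -- Sums along shifted diagonals; shift `0` gives the trace.
  set τ : ι → (Fin n → ZMod 2) → ℂ := fun i t => ∑ x, L i x (x + t)
  -- Fidelity hypothesis on the computational basis: most of the weight lies on the diagonal.
  have h1 : d * (1 - ε) ≤ ∑ i, ∑ x, ‖L i x x‖ ^ 2 := by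
    rw [Finset.sum_comm, ← hconst]
    refine Finset.sum_le_sum fun x _ => ?_
    have := hε (Pi.single x 1) (by simp [normSq, Pi.single_apply, apply_ite])
    refine this.trans_eq (Finset.sum_congr rfl fun i _ => ?_)
    rw [Matrix.mulVec_single_one]
    simp [dotProduct, Pi.single_apply, apply_ite]
  -- Fidelity hypothesis on the character basis. The matrix element at `a` is the Fourier transform
  -- of `τ i`, so Parseval applies.
  have h2 : d * (1 - ε) ≤ d⁻¹ * ∑ i, ∑ t, ‖τ i t‖ ^ 2 := by
    have hv : ∀ a : Fin n → ZMod 2,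
        1 - ε ≤ ∑ i, d⁻¹ ^ 2 * ‖∑ t, bitChar a t * τ i t‖ ^ 2 := by
      intro a
      have hs : ‖((√d : ℝ) : ℂ)⁻¹‖ ^ 2 = d⁻¹ := by
        rw [norm_inv, inv_pow, Complex.norm_of_nonneg (Real.sqrt_nonneg _), Real.sq_sqrt hd0.le]
      have := hε (fun x => ((√d : ℝ) : ℂ)⁻¹ * bitChar a x) (by
        simp only [normSq, norm_mul, norm_bitChar, mul_one, hs, hconst]
        exact mul_inv_cancel₀ hd0.ne')
      refine this.trans_eq (Finset.sum_congr rfl fun i _ => ?_)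
      have he : (star fun x => ((√d : ℝ) : ℂ)⁻¹ * bitChar a x) ⬝ᵥ
          (L i *ᵥ fun x => ((√d : ℝ) : ℂ)⁻¹ * bitChar a x)
          = ((d⁻¹ : ℝ) : ℂ) * ∑ t, bitChar a t * τ i t := by
        have hdd : ((√d : ℝ) : ℂ)⁻¹ * ((√d : ℝ) : ℂ)⁻¹ = ((d⁻¹ : ℝ) : ℂ) := by
          rw [← mul_inv, ← Complex.ofReal_mul, Real.mul_self_sqrt hd0.le, Complex.ofReal_inv]
        simp only [dotProduct, Matrix.mulVec, Pi.star_apply, star_mul', star_bitChar, τ,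
          Finset.mul_sum]
        rw [Finset.sum_comm (γ := Fin n → ZMod 2)]
        conv_rhs => rw [Finset.sum_comm]
        rw [Finset.sum_comm]
        refine Finset.sum_congr rfl fun x _ => ?_
        rw [← Equiv.sum_comp (Equiv.addLeft x)]
        refine Finset.sum_congr rfl fun t _ => ?_
        have hb : bitChar a x * bitChar a (x + t) = bitChar a t := by
          rw [← bitChar_add_right, ← add_assoc, add_self_bits, zero_add]
        simp only [Equiv.coe_addLeft, RCLike.star_def, map_inv₀, Complex.conj_ofReal]
        rw [← hdd, ← hb]
        ring
      rw [he, norm_mul, Complex.norm_of_nonneg (inv_nonneg.2 hd0.le), mul_pow]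
    rw [← hconst]
    refine (Finset.sum_le_sum fun a _ => hv a).trans_eq ?_
    rw [Finset.sum_comm, Finset.mul_sum]
    refine Finset.sum_congr rfl fun i _ => ?_
    rw [← Finset.mul_sum, sum_norm_sum_bitChar_mul_sq, ← hd]
    field_simp
  have h3 : ∀ i t, ‖τ i t‖ ^ 2 ≤ d * ∑ x, ‖L i x (x + t)‖ ^ 2 := by
    intro i t
    rw [← hcard]
    exact norm_sum_sq_le_card_mul _
  have h4 : ∑ i, ∑ t, ∑ x, ‖L i x (x + t)‖ ^ 2 = d := by
    have hF : ∀ i, ((∑ t, ∑ x, ‖L i x (x + t)‖ ^ 2 : ℝ) : ℂ) = ((L i)ᴴ * L i).trace := by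
      intro i
      rw [Finset.sum_comm]
      push_cast
      simp only [Matrix.trace, Matrix.diag_apply, Matrix.mul_apply, Matrix.conjTranspose_apply]
      rw [Finset.sum_comm (f := fun y x => star (L i x y) * L i x y)]
      refine Finset.sum_congr rfl fun x _ => ?_
      refine Eq.trans ?_ (Equiv.sum_comp (Equiv.addLeft x) _)
      refine Finset.sum_congr rfl fun t _ => ?_
      simp [Complex.conj_mul']
    have : ((∑ i, ∑ t, ∑ x, ‖L i x (x + t)‖ ^ 2 : ℝ) : ℂ) = (d : ℂ) := by
      rw [Complex.ofReal_sum]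
      simp only [hF]
      rw [← Matrix.trace_sum, hL, Matrix.trace_one]
      exact_mod_cast hcard
    exact_mod_cast this
  -- Nonzero shifts involve off-diagonal entries only. Their total weight is at most `d * ε` by `h1`
  -- and `h4`, so almost all of the sum in `h2` comes from the trace.
  have h5 : ∀ i, ∑ t, ‖τ i t‖ ^ 2 ≤ ‖(L i).trace‖ ^ 2
      + d * (∑ t, ∑ x, ‖L i x (x + t)‖ ^ 2 - ∑ x, ‖L i x x‖ ^ 2) := by
    intro i
    rw [← Finset.add_sum_erase _ _ (Finset.mem_univ (0 : Fin n → ZMod 2)),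
      ← Finset.add_sum_erase _ (fun t => ∑ x, ‖L i x (x + t)‖ ^ 2)
        (Finset.mem_univ (0 : Fin n → ZMod 2))]
    have e1 : τ i 0 = (L i).trace := by simp [τ, Matrix.trace]
    simp only [e1, add_zero, add_sub_cancel_left, Finset.mul_sum (s := Finset.erase _ _)]
    gcongr with t
    exact h3 i t
  have h6 := Finset.sum_le_sum fun i (_ : i ∈ Finset.univ) => h5 i
  rw [Finset.sum_add_distrib, ← Finset.mul_sum, Finset.sum_sub_distrib, h4] at h6
  have h7 : d * (d * (1 - ε)) ≤ ∑ i, ∑ t, ‖τ i t‖ ^ 2 := by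
    have := mul_le_mul_of_nonneg_left h2 hd0.le
    rwa [← mul_assoc d d⁻¹, mul_inv_cancel₀ hd0.ne', one_mul] at this
  nlinarith [mul_le_mul_of_nonneg_left h1 hd0.le]

/-! ### The Pauli-twirled encoding gadget -/

theorem isDensity_vecMulVec {a : Type} [Fintype a] {v : a → ℂ} (hv : normSq v = 1) :
    IsDensity (Matrix.vecMulVec v (star v)) := by
  refine ⟨Matrix.posSemidef_vecMulVec_self_star v, ?_⟩
  rw [Matrix.trace_vecMulVec, dotProduct_comm, star_dotProduct_self, hv, Complex.ofReal_one]

theorem IsDensity.map {a b : Type} [Fintype a] [Fintype b]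
    {Φ : Matrix a a ℂ →ₗ[ℂ] Matrix b b ℂ} (hΦ : IsCP Φ) (hΦ' : IsTP Φ) {ρ : Matrix a a ℂ}
    (hρ : IsDensity ρ) : IsDensity (Φ ρ) := ⟨hΦ.posSemidef hρ.1, (hΦ' ρ).trans hρ.2⟩

theorem normSq_resourceState {n : ℕ} (g : (Fin n → ZMod 2) → ZMod 2) :
    normSq (resourceState g) = 1 := by
  have h : ∀ x, ‖resourceState g x‖ ^ 2 = (2 ^ n)⁻¹ := by
    intro x
    rw [resourceState, qramUnitary, Matrix.mulVec_diagonal, norm_mul, norm_pow, norm_neg, norm_one,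
      one_pow, one_mul, plusState, Complex.norm_of_nonneg (by positivity), inv_pow,
      Real.sq_sqrt (by positivity)]
  simp [normSq, h]

namespace CodeWithGadgets

variable {n : ℕ} (C : CodeWithGadgets n)

theorem projector_mul_qec (M : Op C.size) : C.E * C.Eᴴ * C.qec M = C.qec M := by
  have h := C.qec_range M
  have hp : C.E * C.Eᴴ * (C.E * C.Eᴴ) = C.E * C.Eᴴ := by
    rw [Matrix.mul_assoc, ← Matrix.mul_assoc C.Eᴴ, C.isometry, Matrix.one_mul]
  rw [← h, ← Matrix.mul_assoc, ← Matrix.mul_assoc (C.E * C.Eᴴ) (C.E * C.Eᴴ), hp]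

/-- Such a `K` is isometric on the code space, which contains the outputs of `qec`. It is used for
decoding by `Eᴴ` and for logical Paulis, neither of which need preserve the trace on its own. -/
theorem isTP_sandwich_comp_qec {b : Type} [Fintype b] {K : Matrix b (Fin C.size → ZMod 2) ℂ}
    (hK : Kᴴ * K = C.E * C.Eᴴ) : IsTP (sandwich K ∘ₗ C.qec) := by
  intro M
  change (K * C.qec M * Kᴴ).trace = M.trace
  rw [Matrix.trace_mul_comm, ← Matrix.mul_assoc, hK, C.projector_mul_qec]
  exact C.qec_channel.2 M

theorem isTP_logicalPauli_comp_qec (P : PauliLabel n) : IsTP (C.logicalPauli P ∘ₗ C.qec) := by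
  refine C.isTP_sandwich_comp_qec ?_
  have : (C.E * pauli P * C.Eᴴ)ᴴ * (C.E * pauli P * C.Eᴴ)
      = C.E * ((pauli P)ᴴ * (C.Eᴴ * C.E) * pauli P) * C.Eᴴ := by
    simp only [Matrix.conjTranspose_mul, Matrix.conjTranspose_conjTranspose, Matrix.mul_assoc]
  rw [this, C.isometry, Matrix.mul_one, pauli_conjTranspose, pauli_mul_self, Matrix.mul_one]

theorem isCP_correct {R : Realization} (hR : R.IsCPTP) : IsCP (C.qec ∘ₗ C.qecGadget.run R) :=
  C.qec_channel.isCP.comp (Circuit.isCP_run hR _)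

theorem isTP_correct {R : Realization} (hR : R.IsCPTP) : IsTP (C.qec ∘ₗ C.qecGadget.run R) :=
  IsTP.comp C.qec_channel.2 (Circuit.isTP_run hR _)

theorem isCP_noisyEncode {R : Realization} (hR : R.IsCPTP) (c : Circuit C.size n) :
    IsCP (C.noisyEncode R c) := (C.isCP_correct hR).comp (Circuit.isCP_run hR c)

theorem isTP_noisyEncode {R : Realization} (hR : R.IsCPTP) (c : Circuit C.size n) :
    IsTP (C.noisyEncode R c) := (C.isTP_correct hR).comp (Circuit.isTP_run hR c)

theorem isCP_gate_first {R : Realization} (hR : R.IsCPTP) (P : PauliLabel n) :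
    IsCP (C.logicalPauli P ∘ₗ C.qec ∘ₗ C.qecGadget.run R) :=
  (isCP_sandwich _).comp (C.isCP_correct hR)

theorem isTP_gate_first {R : Realization} (hR : R.IsCPTP) (P : PauliLabel n) :
    IsTP (C.logicalPauli P ∘ₗ C.qec ∘ₗ C.qecGadget.run R) :=
  (C.isTP_logicalPauli_comp_qec P).comp (Circuit.isTP_run hR _)

theorem isCP_gate_last {R : Realization} (hR : R.IsCPTP) (P : PauliLabel n) :
    IsCP (C.qec ∘ₗ C.qecGadget.run R ∘ₗ (C.pauliGadget P).run R ∘ₗ C.qecGadget.run R) :=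
  (C.isCP_correct hR).comp ((Circuit.isCP_run hR _).comp (Circuit.isCP_run hR _))

theorem isTP_gate_last {R : Realization} (hR : R.IsCPTP) (P : PauliLabel n) :
    IsTP (C.qec ∘ₗ C.qecGadget.run R ∘ₗ (C.pauliGadget P).run R ∘ₗ C.qecGadget.run R) :=
  (C.isTP_correct hR).comp (IsTP.comp (Circuit.isTP_run hR _) (Circuit.isTP_run hR _))

theorem gateError_nonneg (R : Realization) (P : PauliLabel n) : 0 ≤ C.gateError R P :=
  mul_nonneg (by norm_num) (diamondNorm_nonneg _)

/-- Both maps compared are channels, so every logical error is at most 1 and the supremum is a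
genuine upper bound. -/
theorem gateError_le_Gam {p : ℝ} (hp0 : 0 ≤ p) (hp1 : p ≤ 1) {R : Realization}
    (hR : R.IsStochasticNoise p) (P : PauliLabel n) : C.gateError R P ≤ C.Gam p := by
  refine le_csSup ⟨1, ?_⟩ ⟨R, hR, P, rfl⟩
  rintro _ ⟨R, hR, P, rfl⟩
  have hC := hR.isCPTP hp0 hp1
  have := diamondNorm_sub_le_two (C.isCP_gate_first hC P) (C.isTP_gate_first hC P)
    (C.isCP_gate_last hC P) (C.isTP_gate_last hC P)
  rw [gateError]
  linarith

theorem Gam_nonneg (p : ℝ) : 0 ≤ C.Gam p :=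
  Real.sSup_nonneg (by rintro _ ⟨R, -, P, rfl⟩; exact C.gateError_nonneg R P)

theorem isCP_encode : IsCP C.encode := isCP_sandwich _

theorem isTP_encode : IsTP C.encode := isTP_sandwich C.isometry

theorem encodingError_nonneg (R : Realization) (c : Circuit C.size n) :
    0 ≤ C.encodingError R c :=
  Real.sSup_nonneg (by rintro _ ⟨ρ, -, rfl⟩; exact mul_nonneg (by norm_num) (traceNorm_nonneg _))

theorem le_encodingError {R : Realization} (hR : R.IsCPTP) (c : Circuit C.size n) {ρ : Op n}
    (hρ : IsDensity ρ) :
    1 / 2 * traceNorm (C.noisyEncode R c ρ - C.encode ρ) ≤ C.encodingError R c := by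
  refine le_csSup ⟨1, ?_⟩ ⟨ρ, hρ, rfl⟩
  rintro _ ⟨ρ, hρ, rfl⟩
  have h1 : traceNorm ρ ≤ 1 := (traceNorm_le_trace hρ.1).trans (by simp [hρ.2])
  have h2 := traceNorm_channel_le (C.isCP_noisyEncode hR c) (C.isTP_noisyEncode hR c) ρ
  have h3 := traceNorm_channel_le C.isCP_encode C.isTP_encode ρ
  linarith [traceNorm_sub_le (C.noisyEncode R c ρ) (C.encode ρ)]

theorem fidelity_encoded {n : ℕ} (C : CodeWithGadgets n) (v : (Fin n → ZMod 2) → ℂ)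
    (M : Op C.size) : fidelity (C.E *ᵥ v) M = fidelity v (C.Eᴴ * M * C.E) := by
  have h := fidelity_mul_mul_conjTranspose v C.Eᴴ M
  rw [Matrix.conjTranspose_conjTranspose] at h
  exact h.symm

/-- The ideally encoded state has fidelity 1, and the half in the trace distance absorbs the 2 in
`two_mul_abs_fidelity_le`. -/
theorem fidelity_noisyEncode_pure_ge {R : Realization} (hR : R.IsCPTP) (c : Circuit C.size n)
    {v : (Fin n → ZMod 2) → ℂ} (hv : normSq v = 1) :
    1 - C.encodingError R c
      ≤ fidelity (C.E *ᵥ v) (C.noisyEncode R c (Matrix.vecMulVec v (star v))) := by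
  have hρ := isDensity_vecMulVec hv
  have h1 := C.le_encodingError hR c hρ
  have hv' : normSq (C.E *ᵥ v) = 1 := (normSq_mulVec_of_isometry C.isometry v).trans hv
  have h2 := two_mul_abs_fidelity_le hv'
    (X := C.noisyEncode R c (Matrix.vecMulVec v (star v)) - C.encode (Matrix.vecMulVec v (star v)))
    (by rw [Matrix.trace_sub, C.isTP_noisyEncode hR c, C.isTP_encode, sub_self])
  have h3 : fidelity (C.E *ᵥ v) (C.encode (Matrix.vecMulVec v (star v))) = 1 := by
    have he : C.encode (Matrix.vecMulVec v (star v))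
        = C.E * Matrix.vecMulVec v (star v) * C.Eᴴ := rfl
    rw [he, fidelity_vecMulVec, star_dotProduct_self, hv']
    simp
  rw [fidelity_sub, h3] at h2
  linarith [neg_abs_le (fidelity (C.E *ᵥ v)
    (C.noisyEncode R c (Matrix.vecMulVec v (star v))) - 1)]

/-- Twirling the noisy encoding with ideal Pauli operators. -/
theorem sum_fidelity_twirl_ge {R : Realization} (hR : R.IsCPTP) (c : Circuit C.size n)
    (v : (Fin n → ZMod 2) → ℂ) {ψ : Op n} (hψ : ψ.PosSemidef) :
    ((2 : ℝ) ^ n) ^ 2 * ((1 - 2 * C.encodingError R c) * fidelity v ψ) ≤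
      ∑ P : PauliLabel n, fidelity (C.E *ᵥ v)
        (C.logicalPauli P (C.noisyEncode R c (sandwich (pauli P) ψ))) := by
  have hTP : IsTP (sandwich C.Eᴴ ∘ₗ C.noisyEncode R c) :=
    (C.isTP_sandwich_comp_qec (K := C.Eᴴ) (by rw [Matrix.conjTranspose_conjTranspose])).comp
      (IsTP.comp (Circuit.isTP_run hR C.qecGadget) (Circuit.isTP_run hR c))
  obtain ⟨ι, _, L, hL⟩ := (isCP_sandwich C.Eᴴ).comp (C.isCP_noisyEncode hR c)
  have hL1 := sum_conjTranspose_mul_eq_one hTP hL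
  have hL' : ∀ M, C.Eᴴ * C.noisyEncode R c M * C.E = ∑ i, L i * M * (L i)ᴴ := by
    intro M
    rw [← hL]
    change _ = C.Eᴴ * C.noisyEncode R c M * C.Eᴴᴴ
    rw [Matrix.conjTranspose_conjTranspose]
  have htr := sum_norm_trace_sq_ge L hL1 (ε := C.encodingError R c) fun u hu => by
    refine (C.fidelity_noisyEncode_pure_ge hR c hu).trans_eq ?_
    rw [C.fidelity_encoded, hL', fidelity_sum]
    exact Finset.sum_congr rfl fun i _ => fidelity_vecMulVec u u (L i)
  -- `Eᴴ E = 1` moves the logical Pauli through the decoder, where it becomes the `n`-qubit Pauli.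
  have hterm : ∀ P : PauliLabel n, fidelity (C.E *ᵥ v)
      (C.logicalPauli P (C.noisyEncode R c (sandwich (pauli P) ψ)))
      = ∑ i, fidelity v (pauli P * (L i * (pauli P * ψ * (pauli P)ᴴ) * (L i)ᴴ) * (pauli P)ᴴ) := by
    intro P
    rw [C.fidelity_encoded, ← fidelity_sum, ← Matrix.sum_mul, ← Matrix.mul_sum, ← hL']
    congr 1
    change C.Eᴴ * ((C.E * pauli P * C.Eᴴ) * C.noisyEncode R c (pauli P * ψ * (pauli P)ᴴ) *
      (C.E * pauli P * C.Eᴴ)ᴴ) * C.E = _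
    calc _ = (C.Eᴴ * C.E) * pauli P *
          (C.Eᴴ * C.noisyEncode R c (pauli P * ψ * (pauli P)ᴴ) * C.E) * (pauli P)ᴴ *
          (C.Eᴴ * C.E) := by
          simp only [Matrix.conjTranspose_mul, Matrix.conjTranspose_conjTranspose,
            Matrix.mul_assoc]
      _ = _ := by rw [C.isometry, Matrix.one_mul, Matrix.mul_one]
  simp only [hterm]
  rw [Finset.sum_comm, ← mul_assoc]
  refine (mul_le_mul_of_nonneg_right htr (fidelity_nonneg v hψ)).trans ?_
  rw [Finset.sum_mul]
  exact Finset.sum_le_sum fun i _ => norm_trace_sq_mul_fidelity_le v (L i) hψ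

theorem card_pauliLabel_inv (n : ℕ) :
    ((Fintype.card (PauliLabel n) : ℝ)⁻¹) = (((2 : ℝ) ^ n) ^ 2)⁻¹ := by
  simp [Fintype.card_prod, sq]

/-- Without noise `qec` fixes the encoded state and the logical Pauli undoes the physical one, so
every branch is the ideal encoding. -/
theorem isEncodingGadget_pauliTwirl {c : Circuit C.size n} (hc : C.IsEncodingGadget c)
    (tag : Fin n → ℕ) : C.IsEncodingGadget (C.pauliTwirl tag c) := by
  refine LinearMap.ext fun ψ => ?_
  have h : ∀ P : PauliLabel n, (pauliLayer tag P
      ((C.pauliGadget P).after (C.qecGadget.after c))).run Realization.ideal ψ = C.encode ψ := by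
    intro P
    rw [run_pauliLayer_ideal, Circuit.run_after, Circuit.run_after, C.qecGadget_ideal, hc]
    change (C.pauliGadget P).run Realization.ideal
      (C.qec (C.E * (pauli P * ψ * (pauli P)ᴴ) * C.Eᴴ)) = C.E * ψ * C.Eᴴ
    rw [C.qec_fixes, C.pauliGadget_ideal, pauli_conjTranspose]
    congr 2
    rw [Matrix.mul_assoc (pauli P) ψ, ← Matrix.mul_assoc, ← Matrix.mul_assoc, pauli_mul_self,
      Matrix.one_mul, Matrix.mul_assoc, pauli_mul_self, Matrix.mul_one]
  simp only [pauliTwirl, Circuit.run, LinearMap.sum_apply, LinearMap.smul_apply, h]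
  rw [← Finset.sum_smul, Finset.sum_const, Finset.card_univ, nsmul_eq_mul]
  push_cast
  rw [mul_inv_cancel₀ (by exact_mod_cast Fintype.card_ne_zero), one_smul]

/-- The three losses combined, for an arbitrary unit vector `v` and with the sharper constants 2 and
1. -/
theorem fidelity_pauliTwirl_ge {p : ℝ} (hp0 : 0 ≤ p) (hp1 : p ≤ 1) (c : Circuit C.size n)
    (tag : Fin n → ℕ) {R : Realization} (hR : R.IsStochasticNoise p)
    {v : (Fin n → ZMod 2) → ℂ} (hv : normSq v = 1) {ψ : Op n} (hψ : IsDensity ψ) :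
    (1 - p) ^ n * ((1 - 2 * C.encodingError R c) * fidelity v ψ - C.Gam p)
      ≤ fidelity (C.E *ᵥ v) (C.noisyEncode R (C.pauliTwirl tag c) ψ) := by
  have hC := hR.isCPTP hp0 hp1
  have hv' : normSq (C.E *ᵥ v) = 1 := (normSq_mulVec_of_isometry C.isometry v).trans hv
  set w : ℝ := (((2 : ℝ) ^ n) ^ 2)⁻¹ with hw
  have hw0 : 0 < w := by positivity
  set T : PauliLabel n → (Op n →ₗ[ℂ] Op C.size) := fun P =>
    (pauliLayer tag P ((C.pauliGadget P).after (C.qecGadget.after c))).run R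
  set A : PauliLabel n → ℝ := fun P => fidelity (C.E *ᵥ v)
    (C.logicalPauli P (C.noisyEncode R c (sandwich (pauli P) ψ)))
  have hT : ∀ P, (1 - p) ^ n * (A P - C.Gam p)
      ≤ fidelity (C.E *ᵥ v) ((C.qec ∘ₗ C.qecGadget.run R) (T P ψ)) := by
    intro P
    obtain ⟨Θ, hΘ, h⟩ := exists_run_pauliLayer_eq hp0 hp1 hR tag P
      ((C.pauliGadget P).after (C.qecGadget.after c))
    have hpos : 0 ≤ fidelity (C.E *ᵥ v) ((C.qec ∘ₗ C.qecGadget.run R) (Θ ψ)) :=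
      fidelity_nonneg _ ((C.isCP_correct hC).posSemidef (hΘ.posSemidef hψ.1))
    have hρ : IsDensity (c.run R (sandwich (pauli P) ψ)) :=
      (hψ.map (isCP_sandwich _) (isTP_sandwich (by rw [pauli_conjTranspose, pauli_mul_self]))).map
        (Circuit.isCP_run hC c) (Circuit.isTP_run hC c)
    have hd := two_mul_abs_fidelity_sub_le_diamondNorm (C.isCP_gate_first hC P)
      (C.isTP_gate_first hC P) (C.isCP_gate_last hC P) (C.isTP_gate_last hC P) hv' hρ
    have hG : C.gateError R P ≤ C.Gam p := C.gateError_le_Gam hp0 hp1 hR P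
    rw [gateError] at hG
    rw [LinearMap.sub_apply, fidelity_sub] at hd
    -- The diamond distance is tested on the actual noisy output of `c`, so no further error of `c`
    -- enters here.
    have hmain : A P - C.Gam p ≤ fidelity (C.E *ᵥ v) ((C.qec ∘ₗ C.qecGadget.run R ∘ₗ
        (C.pauliGadget P).run R ∘ₗ C.qecGadget.run R) (c.run R (sandwich (pauli P) ψ))) := by
      have := (le_abs_self _).trans
        ((le_div_iff₀' two_pos).2 hd |>.trans (by linarith : _ ≤ C.Gam p))
      have hA : A P = fidelity (C.E *ᵥ v) ((C.logicalPauli P ∘ₗ C.qec ∘ₗ C.qecGadget.run R)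
        (c.run R (sandwich (pauli P) ψ))) := rfl
      linarith
    have hsplit : (C.qec ∘ₗ C.qecGadget.run R) (T P ψ)
        = (((1 - p) ^ n : ℝ) : ℂ) • (C.qec ∘ₗ C.qecGadget.run R ∘ₗ (C.pauliGadget P).run R ∘ₗ
            C.qecGadget.run R) (c.run R (sandwich (pauli P) ψ))
          + (C.qec ∘ₗ C.qecGadget.run R) (Θ ψ) := by
      simp only [T, h, LinearMap.add_apply, map_add, LinearMap.smul_apply, map_smul,
        Circuit.run_after]
      rfl
    rw [hsplit, fidelity_add, fidelity_smul]
    have := mul_le_mul_of_nonneg_left hmain (pow_nonneg (sub_nonneg.2 hp1) n)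
    linarith
  have hrun : C.noisyEncode R (C.pauliTwirl tag c) ψ
      = ∑ P, ((w : ℝ) : ℂ) • (C.qec ∘ₗ C.qecGadget.run R) (T P ψ) := by
    simp only [noisyEncode, pauliTwirl, Circuit.run, card_pauliLabel_inv, ← hw, T]
    simp only [LinearMap.comp_apply, LinearMap.sum_apply, map_sum, LinearMap.smul_apply, map_smul]
  rw [hrun, fidelity_sum]
  simp only [fidelity_smul]
  have htw := C.sum_fidelity_twirl_ge hC c v hψ.1
  have hone : ∑ _P : PauliLabel n, w = 1 := by
    rw [Finset.sum_const, Finset.card_univ, nsmul_eq_mul, hw, ← card_pauliLabel_inv]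
    exact mul_inv_cancel₀ (by positivity)
  have havg : (1 - 2 * C.encodingError R c) * fidelity v ψ ≤ ∑ P, w * A P := by
    rw [← Finset.mul_sum, hw, inv_mul_eq_div, le_div_iff₀' (by positivity)]
    exact htw
  calc (1 - p) ^ n * ((1 - 2 * C.encodingError R c) * fidelity v ψ - C.Gam p)
      ≤ (1 - p) ^ n * (∑ P, w * A P - C.Gam p) :=
        mul_le_mul_of_nonneg_left (sub_le_sub_right havg _) (pow_nonneg (sub_nonneg.2 hp1) n)
    _ = ∑ P, w * ((1 - p) ^ n * (A P - C.Gam p)) := by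
        have : ∀ P, w * ((1 - p) ^ n * (A P - C.Gam p))
            = (1 - p) ^ n * (w * A P) - (1 - p) ^ n * C.Gam p * w := fun P => by ring
        simp only [this, Finset.sum_sub_distrib, ← Finset.mul_sum, hone]
        ring
    _ ≤ _ := Finset.sum_le_sum fun P _ => mul_le_mul_of_nonneg_left (hT P) hw0.le

end CodeWithGadgets

theorem mainTheorem8 {n : ℕ} (S : ℕ → CodeWithGadgets n) (p : ℝ) (hp0 : 0 ≤ p) (hp1 : p ≤ 1) :
    (∀ (k : ℕ) (c : Circuit (S k).size n), (S k).IsEncodingGadget c →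
      ∀ tag : Fin n → ℕ, ∃ cFT : Circuit (S k).size n,
        cFT = (S k).pauliTwirl tag c ∧
        (S k).IsEncodingGadget cFT ∧
        ∀ R : Realization, R.IsStochasticNoise p →
          ∀ (g : (Fin n → ZMod 2) → ZMod 2) (ψ : Op n), IsDensity ψ →
            (1 - p) ^ n *
                ((1 - 3 * (S k).encodingError R c) * fidelity (resourceState g) ψ
                  - 2 * (S k).Gam p)
              ≤ fidelity ((S k).E *ᵥ resourceState g) ((S k).noisyEncode R cFT ψ)) ∧
    (∀ p₀ : ℝ, HasThreshold S p₀ → p < p₀ →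
      Filter.Tendsto (fun k => (S k).Gam p) Filter.atTop (nhds 0)) := by
  refine ⟨fun k c hc tag => ⟨_, rfl, (S k).isEncodingGadget_pauliTwirl hc tag,
    fun R hR g ψ hψ => ?_⟩, fun p₀ hS hp => ?_⟩
  -- The slack between the two bounds is ε F + Γ, which is nonnegative.
  · refine le_trans (mul_le_mul_of_nonneg_left ?_ (pow_nonneg (sub_nonneg.2 hp1) n))
      ((S k).fidelity_pauliTwirl_ge hp0 hp1 c tag hR (normSq_resourceState g) hψ)
    have hF := fidelity_nonneg (resourceState g) hψ.1
    have := mul_nonneg ((S k).encodingError_nonneg R c) hF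
    linarith [(S k).Gam_nonneg p]
  · rw [Metric.tendsto_atTop]
    intro ε hε
    obtain ⟨K, hK⟩ := hS.2 p hp0 hp (ε / 2) (half_pos hε)
    refine ⟨K, fun k hk => ?_⟩
    rw [Real.dist_eq, sub_zero, abs_of_nonneg ((S k).Gam_nonneg p)]
    -- Halving `ε` turns the non-strict threshold bound into a strict one; `Real.sSup_le` needs only
    -- that the bound is nonnegative.
    refine lt_of_le_of_lt (Real.sSup_le ?_ (half_pos hε).le) (half_lt_self hε)
    rintro _ ⟨R, hR, P, rfl⟩
    exact hK k hk R hR P
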